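/- **Wigner–Eckart theorem for $q$-tensor operators.** Let $\mathfrak g$ be a simple complex Lie algebra with Cartan matrix $(a_{ij})$, symmetriser $(d_i)$ and invariant form $(\alpha_i,\alpha_j)=d_ia_{ij}$. Let $q=e^{h}\in\mathbb C^\times$ be not a root of unity, and let $\mathcal J_q=U_q(\mathfrak g)$ be generated by $k_i^{\pm1}=q^{\pm H_i}$, $X_i^\pm$ with the Drinfeld–Jimbo relations, where $k_iX_j^\pm k_i^{-1}=q^{\pm d_ia_{ij}/2}X_j^\pm$ and $[X^+_i,X^-_j]=\delta_{ij}(k_i^2-k_i^{-2})/(q^{d_i}-q^{-d_i})$, and with the coproduct $\Delta k_i=k_i\otimes k_i$, $\Delta X_i^\pm=X_i^\pm\otimes k_i^{-1}+k_i\otimes X_i^\pm$. "Representation" means finite-dimensional representation with integral weights ($k_i$ acts on the weight space of $\lambda$ by $q^{(\lambda,\alpha_i)/2}$). Let $\mathcal R$ be the universal $R$-matrix: an invertible element of the completion of $\mathcal J_q\otimes\mathcal J_q$ that acts on tensor products of representations, with $\mathcal R\,\Delta(\xi)=\Delta'(\xi)\,\mathcal R$, $(\mathrm{id}\otimes\Delta)\mathcal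 R=\mathcal R_{13}\mathcal R_{12}$, $(\Delta\otimes\mathrm{id})\mathcal R=\mathcal R_{13}\mathcal R_{23}$, normalised so that on vectors of weights $\lambda,\mu$ it is multiplication by $q^{(\lambda,\mu)}$ up to terms of weights $\lambda-\beta,\ \mu+\beta$ with $\beta\neq0$ a sum of simple roots. Here $\Delta'=\sigma\circ\Delta$ with $\sigma$ the flip, and $\mathcal R'=\sigma(\mathcal R)$. Put $$L_+^I=(\rho^I\otimes \mathrm{id})\mathcal R,\quad L_-^I=(\rho^I\otimes \mathrm{id})(\mathcal R')^{-1},\quad R_+^{IJ}=(\rho^I\otimes\rho^J)\mathcal R,\quad R_-^{IJ}=(\rho^I\otimes\rho^J)(\mathcal R')^{-1}.$$ Let $\mathcal M=\bigoplus_K V^K$ be the model space, the direct sum of all irreducible representations with multiplicity one, with a basis $|K m\rangle$, $m=1,\dots,\dim V^K$, of each $V^K$. Let $\rho^{I_0}$ be a nontrivial irreducible representation (for example the fundamental one), let $\rho^J$ be any representation with a chosen basis, and let $T^J_1,\dots,T^J_{\dim \rho^J}\in\mathrm{End}\,\mathcal M$ form a $q$-tensor operator, in the sense that the row $U^J=(T^J_1,\dots,T^J_{\dim\rho^J})$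 satisfies $$\overset{1}{L}{}^{I_0}_{\pm}\,\overset{2}{U}{}^J=\overset{2}{U}{}^J\,R^{I_0J}_{\pm}\,\overset{1}{L}{}^{I_0}_{\pm}.$$ For every irreducible $V^I$ fix Clebsch–Gordan maps $C^a[IJK]:V^I\otimes V^J\to V^K$, $C'^a[IJK]:V^K\to V^I\otimes V^J$, where $a$ numbers the copies of $V^K$ in $V^I\otimes V^J$ (so there is no label $a$ if the multiplicity is one). That is, they intertwine the actions of $\mathcal J_q$, with $\mathcal J_q$ acting on $V^I\otimes V^J$ through $(\rho^I\otimes\rho^J)\Delta$, and $\sum_{K,a}C'^a[IJK]\,C^a[IJK]=1$, $C^a[IJK]\,C'^b[IJL]=\delta_{KL}\delta_{ab}$. Let the Clebsch–Gordan coefficients $\left\{\begin{smallmatrix}I&J&K\\ m'&m&m''\end{smallmatrix}\right\}_a$ be the matrix entries of $C^a[IJK]$ in the chosen bases. Then there are numbers $\|T^J\|^a_{IK}$ (reduced matrix elements), independent of $m,m',m''$, such that for all $I,m,m'$ $$T^J_m\,|I m'\rangle=\sum_{K,a}\|T^J\|^a_{IK}\sum_{m''}\left\{\begin{smallmatrix}I&J&K\\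 m'&m&m''\end{smallmatrix}\right\}_a|K m''\rangle ,$$ equivalently $\langle K m''|T^J_m|I m'\rangle=\sum_a\|T^J\|^a_{IK}\left\{\begin{smallmatrix}I&J&K\\ m'&m&m''\end{smallmatrix}\right\}_a$ for all $I,K,m,m',m''$. In particular, if $V^K$ occurs in $V^I\otimes V^J$ with multiplicity one, then $$\langle K m''|T^J_m|I m'\rangle=\|T^J\|_{IK}\left\{\begin{smallmatrix}I&J&K\\ m'&m&m''\end{smallmatrix}\right\}$$ (and these matrix elements vanish if $V^K$ does not occur). -/

import Mathlib

open scoped TensorProduct DirectSum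

noncomputable section

namespace QG

/-! ### Quantised enveloping algebras of simple Lie algebras -/

/-- The Cartan matrix `A i j = ⟨α_i^∨, α_j⟩` of a simple complex Lie algebra (an indecomposable
Cartan matrix of finite type), with a symmetriser `d`, so that `(α_i, α_j) = d i * A i j`. -/
structure CartanDatum (ι : Type*) [Fintype ι] [DecidableEq ι] where
  A : Matrix ι ι ℤ
  d : ι → ℕ
  d_pos : ∀ i, 0 < d i
  diag : ∀ i, A i i = 2
  offDiag : ∀ i j, i ≠ j → A i j ≤ 0
  posDef : (Matrix.of fun i j => (d i : ℝ) * (A i j : ℝ)).PosDef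
  nonempty : Nonempty ι
  indecomposable : ∀ S : Finset ι, S.Nonempty → S ≠ Finset.univ → ∃ i ∈ S, ∃ j ∉ S, A i j ≠ 0

/-- The power `q ^ x` for `q = exp h`. -/
def qpow (h x : ℂ) : ℂ := Complex.exp (h * x)

/-- Iterated `c`-commutators: `z ↦ x z - c_t z x` for `t = 0, …, n - 1`, starting at `y`. -/
def iterComm {B : Type*} [Ring B] [Algebra ℂ B] (c : ℕ → ℂ) (x y : B) : ℕ → B
  | 0 => y
  | n + 1 => x * iterComm c x y n - c n • (iterComm c x y n * x)

/-- Generators: `k i = q ^ (H_i)`, its inverse, and `X s i = X_i^±` for `s = ±1`. Here `H_i` is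
`d i / 2` times the simple coroot. -/
inductive Gen (ι : Type*)
  | k : ι → Gen ι
  | kInv : ι → Gen ι
  | X : ℤˣ → ι → Gen ι

variable {ι : Type*} [Fintype ι] [DecidableEq ι]

/-- The coefficients `q_i ^ (a_ij + 2 t)`, `q_i = q ^ (d i)`. For `t = 0, …, -a_ij` they run through
`q_i ^ (a_ij), q_i ^ (a_ij + 2), …, q_i ^ (-a_ij)`. -/
def serreCoeff (D : CartanDatum ι) (h : ℂ) (i j : ι) (t : ℕ) : ℂ :=
  qpow h ((D.d i : ℂ) * ((D.A i j : ℂ) + 2 * (t : ℂ)))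

/-- The defining relations of `U_q(g)`. The quantum Serre relation
`∑_s (-1)^s [1 - a_ij choose s]_{q_i} X_i^(1 - a_ij - s) X_j X_i^s = 0` is written in its factorised
form, as an iterated `q`-commutator. -/
inductive Rel (D : CartanDatum ι) (h : ℂ) : FreeAlgebra ℂ (Gen ι) → FreeAlgebra ℂ (Gen ι) → Prop
  | k_kInv (i : ι) : Rel D h (FreeAlgebra.ι ℂ (Gen.k i) * FreeAlgebra.ι ℂ (Gen.kInv i)) 1
  | kInv_k (i : ι) : Rel D h (FreeAlgebra.ι ℂ (Gen.kInv i) * FreeAlgebra.ι ℂ (Gen.k i)) 1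
  | k_k (i j : ι) : Rel D h (FreeAlgebra.ι ℂ (Gen.k i) * FreeAlgebra.ι ℂ (Gen.k j))
      (FreeAlgebra.ι ℂ (Gen.k j) * FreeAlgebra.ι ℂ (Gen.k i))
  | k_X (s : ℤˣ) (i j : ι) : Rel D h (FreeAlgebra.ι ℂ (Gen.k i) * FreeAlgebra.ι ℂ (Gen.X s j))
      (qpow h (((s : ℤ) : ℂ) * (D.d i : ℂ) * (D.A i j : ℂ) / 2) •
        (FreeAlgebra.ι ℂ (Gen.X s j) * FreeAlgebra.ι ℂ (Gen.k i)))
  | X_X_same (i : ι) : Rel D h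
      (FreeAlgebra.ι ℂ (Gen.X 1 i) * FreeAlgebra.ι ℂ (Gen.X (-1) i)
        - FreeAlgebra.ι ℂ (Gen.X (-1) i) * FreeAlgebra.ι ℂ (Gen.X 1 i))
      ((qpow h (D.d i) - qpow h (-(D.d i)))⁻¹ •
        (FreeAlgebra.ι ℂ (Gen.k i) ^ 2 - FreeAlgebra.ι ℂ (Gen.kInv i) ^ 2))
  | X_X_ne (i j : ι) (hij : i ≠ j) : Rel D h
      (FreeAlgebra.ι ℂ (Gen.X 1 i) * FreeAlgebra.ι ℂ (Gen.X (-1) j))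
      (FreeAlgebra.ι ℂ (Gen.X (-1) j) * FreeAlgebra.ι ℂ (Gen.X 1 i))
  | serre (s : ℤˣ) (i j : ι) (hij : i ≠ j) : Rel D h
      (iterComm (serreCoeff D h i j) (FreeAlgebra.ι ℂ (Gen.X s i)) (FreeAlgebra.ι ℂ (Gen.X s j))
        (1 - D.A i j).toNat) 0

/-- The quantised enveloping algebra `U_q(g)`, `q = exp h`. -/
def Uq (D : CartanDatum ι) (h : ℂ) : Type _ := RingQuot (Rel D h)

instance (D : CartanDatum ι) (h : ℂ) : Ring (Uq D h) := inferInstanceAs (Ring (RingQuot (Rel D h)))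

instance (D : CartanDatum ι) (h : ℂ) : Algebra ℂ (Uq D h) :=
  inferInstanceAs (Algebra ℂ (RingQuot (Rel D h)))

/-- The quotient map onto `U_q(g)`. -/
def mk (D : CartanDatum ι) (h : ℂ) : FreeAlgebra ℂ (Gen ι) →ₐ[ℂ] Uq D h :=
  RingQuot.mkAlgHom ℂ (Rel D h)

/-- The generators as elements of `U_q(g)`. -/
def gen (D : CartanDatum ι) (h : ℂ) (g : Gen ι) : Uq D h := mk D h (FreeAlgebra.ι ℂ g)

/-- The values of the coproduct on the generators: `Δ(k_i) = k_i ⊗ k_i`,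
`Δ(X_i^±) = X_i^± ⊗ k_i⁻¹ + k_i ⊗ X_i^±`. -/
def comulGen (D : CartanDatum ι) (h : ℂ) : Gen ι → Uq D h ⊗[ℂ] Uq D h
  | Gen.k i => gen D h (Gen.k i) ⊗ₜ gen D h (Gen.k i)
  | Gen.kInv i => gen D h (Gen.kInv i) ⊗ₜ gen D h (Gen.kInv i)
  | Gen.X s i => gen D h (Gen.X s i) ⊗ₜ gen D h (Gen.kInv i)
      + gen D h (Gen.k i) ⊗ₜ gen D h (Gen.X s i)

/-! ### Lemmas showing that the coproduct respects the relations -/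
section lemmas

variable {B B' : Type*} [Ring B] [Algebra ℂ B] [Ring B'] [Algebra ℂ B']

theorem qpow_add (h x y : ℂ) : qpow h (x + y) = qpow h x * qpow h y := by
  simp [qpow, mul_add, Complex.exp_add]

theorem qpow_zero (h : ℂ) : qpow h 0 = 1 := by simp [qpow]

theorem map_iterComm (f : B →ₐ[ℂ] B') (c : ℕ → ℂ) (x y : B) (n : ℕ) :
    f (iterComm c x y n) = iterComm c (f x) (f y) n := by
  induction n with
  | zero => rfl
  | succ n ih => simp [iterComm, ih]

theorem iterComm_add (c : ℕ → ℂ) (x y y' : B) (n : ℕ) :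
    iterComm c x (y + y') n = iterComm c x y n + iterComm c x y' n := by
  induction n with
  | zero => rfl
  | succ n ih => simp only [iterComm, ih, mul_add, add_mul, smul_add]; abel

theorem iterComm_comm (c : ℕ → ℂ) (b : ℂ) (x y : B) (n : ℕ) :
    x * iterComm c x y n - b • (iterComm c x y n * x)
      = iterComm c x (x * y - b • (y * x)) n := by
  induction n with
  | zero => rfl
  | succ n ih =>
    simp only [iterComm]
    rw [← ih]
    simp only [mul_sub, sub_mul, mul_smul_comm, smul_mul_assoc, smul_sub, mul_assoc]
    rw [smul_comm b (c n)]
    abel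

theorem iterComm_shift (c : ℕ → ℂ) (x y : B) (n : ℕ) :
    iterComm c x y (n + 1) = iterComm (fun t => c (t + 1)) x (x * y - c 0 • (y * x)) n := by
  induction n with
  | zero => rfl
  | succ n ih =>
    rw [iterComm, ih]
    rfl

theorem iterComm_congr {c c' : ℕ → ℂ} (x y : B) (n : ℕ) (hc : ∀ t < n, c t = c' t) :
    iterComm c x y n = iterComm c' x y n := by
  induction n with
  | zero => rfl
  | succ n ih =>
    rw [iterComm, iterComm, ih fun t ht => hc t (by omega), hc n (by omega)]

theorem iterComm_reverse (c : ℕ → ℂ) (x y : B) (n : ℕ) :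
    iterComm c x y n = iterComm (fun t => c (n - 1 - t)) x y n := by
  induction n generalizing y with
  | zero => rfl
  | succ n ih =>
    rw [iterComm, iterComm_comm, ih, iterComm_shift]
    simp only [Nat.add_sub_cancel, Nat.sub_zero]
    refine iterComm_congr _ _ _ fun t ht => ?_
    congr 1
    omega

theorem iterComm_split (c : ℕ → ℂ) (P : ℂ) (hc : ∀ t, c (t + 1) = P * c t) (x₁ x₂ y : B)
    (h₁ : x₂ * x₁ = P • (x₁ * x₂)) (h₂ : x₂ * y = c 0 • (y * x₂)) (n : ℕ) :
    iterComm c (x₁ + x₂) y n = iterComm c x₁ y n ∧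
      x₂ * iterComm c x₁ y n = c n • (iterComm c x₁ y n * x₂) := by
  induction n with
  | zero => exact ⟨rfl, h₂⟩
  | succ n ih =>
    obtain ⟨ih₁, ih₂⟩ := ih
    constructor
    · simp only [iterComm, ih₁, add_mul, mul_add, smul_add, ih₂]
      abel
    · simp only [iterComm, mul_sub, sub_mul, mul_smul_comm, smul_mul_assoc]
      rw [← mul_assoc x₂ x₁, h₁, ← mul_assoc x₂ _ x₁, ih₂, smul_mul_assoc, smul_mul_assoc,
        mul_assoc x₁ x₂, ih₂, mul_assoc _ x₂ x₁, h₁, hc]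
      simp only [mul_smul_comm, smul_sub, smul_smul, mul_assoc]
      (congr 2; ring)

theorem iterComm_tmul (c : ℕ → ℂ) (x y : B) (u w : B') (huw : u * w = w * u) (n : ℕ) :
    iterComm c (x ⊗ₜ[ℂ] u) (y ⊗ₜ[ℂ] w) n = iterComm c x y n ⊗ₜ[ℂ] (u ^ n * w) := by
  induction n with
  | zero => simp [iterComm]
  | succ n ih =>
    have h1 : u * (u ^ n * w) = u ^ (n + 1) * w := by rw [pow_succ', mul_assoc]
    have h2 : u ^ n * w * u = u ^ (n + 1) * w := by rw [mul_assoc, ← huw, pow_succ, mul_assoc]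
    simp only [iterComm, ih, Algebra.TensorProduct.tmul_mul_tmul, h1, h2, TensorProduct.sub_tmul,
      TensorProduct.smul_tmul']

theorem iterComm_tmul' (c : ℕ → ℂ) (x y : B) (u w : B') (huw : u * w = w * u) (n : ℕ) :
    iterComm c (u ⊗ₜ[ℂ] x) (w ⊗ₜ[ℂ] y) n = (u ^ n * w) ⊗ₜ[ℂ] iterComm c x y n := by
  induction n with
  | zero => simp [iterComm]
  | succ n ih =>
    have h1 : u * (u ^ n * w) = u ^ (n + 1) * w := by rw [pow_succ', mul_assoc]
    have h2 : u ^ n * w * u = u ^ (n + 1) * w := by rw [mul_assoc, ← huw, pow_succ, mul_assoc]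
    simp only [iterComm, ih, Algebra.TensorProduct.tmul_mul_tmul, h1, h2, TensorProduct.tmul_sub,
      TensorProduct.tmul_smul]

end lemmas

section relations

variable (D : CartanDatum ι) (h : ℂ)

theorem mk_rel {a b : FreeAlgebra ℂ (Gen ι)} (hab : Rel D h a b) : mk D h a = mk D h b :=
  RingQuot.mkAlgHom_rel ℂ hab

theorem k_kInv (i : ι) : gen D h (Gen.k i) * gen D h (Gen.kInv i) = 1 := by
  simpa [gen] using mk_rel D h (Rel.k_kInv (D := D) (h := h) i)

theorem kInv_k (i : ι) : gen D h (Gen.kInv i) * gen D h (Gen.k i) = 1 := by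
  simpa [gen] using mk_rel D h (Rel.kInv_k (D := D) (h := h) i)

theorem k_k (i j : ι) :
    gen D h (Gen.k i) * gen D h (Gen.k j) = gen D h (Gen.k j) * gen D h (Gen.k i) := by
  simpa [gen] using mk_rel D h (Rel.k_k (D := D) (h := h) i j)

theorem k_X (s : ℤˣ) (i j : ι) : gen D h (Gen.k i) * gen D h (Gen.X s j)
    = qpow h (((s : ℤ) : ℂ) * (D.d i : ℂ) * (D.A i j : ℂ) / 2) •
      (gen D h (Gen.X s j) * gen D h (Gen.k i)) := by
  simpa [gen] using mk_rel D h (Rel.k_X (D := D) (h := h) s i j)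

theorem X_X_same (i : ι) :
    gen D h (Gen.X 1 i) * gen D h (Gen.X (-1) i) - gen D h (Gen.X (-1) i) * gen D h (Gen.X 1 i)
      = (qpow h (D.d i) - qpow h (-(D.d i)))⁻¹ •
        (gen D h (Gen.k i) ^ 2 - gen D h (Gen.kInv i) ^ 2) := by
  simpa [gen] using mk_rel D h (Rel.X_X_same (D := D) (h := h) i)

theorem X_X_ne (i j : ι) (hij : i ≠ j) :
    gen D h (Gen.X 1 i) * gen D h (Gen.X (-1) j) = gen D h (Gen.X (-1) j) * gen D h (Gen.X 1 i) := by
  simpa [gen] using mk_rel D h (Rel.X_X_ne (D := D) (h := h) i j hij)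

theorem serre (s : ℤˣ) (i j : ι) (hij : i ≠ j) :
    iterComm (serreCoeff D h i j) (gen D h (Gen.X s i)) (gen D h (Gen.X s j))
      (1 - D.A i j).toNat = 0 := by
  have := mk_rel D h (Rel.serre (D := D) (h := h) s i j hij)
  rw [map_iterComm, map_zero] at this
  exact this

theorem kInv_kInv (i j : ι) :
    gen D h (Gen.kInv i) * gen D h (Gen.kInv j)
      = gen D h (Gen.kInv j) * gen D h (Gen.kInv i) := by
  have e : Commute (gen D h (Gen.k i)) (gen D h (Gen.k j)) := k_k D h i j
  let u (i : ι) : (Uq D h)ˣ := ⟨gen D h (Gen.k i), gen D h (Gen.kInv i), k_kInv D h i, kInv_k D h i⟩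
  have e' : Commute (u i : Uq D h) (u j) := e
  exact (e'.units_inv_left.units_inv_right).eq

theorem X_kInv (s : ℤˣ) (i j : ι) : gen D h (Gen.X s j) * gen D h (Gen.kInv i)
    = qpow h (((s : ℤ) : ℂ) * (D.d i : ℂ) * (D.A i j : ℂ) / 2) •
      (gen D h (Gen.kInv i) * gen D h (Gen.X s j)) := by
  have e : gen D h (Gen.kInv i) * (gen D h (Gen.k i) * gen D h (Gen.X s j)) * gen D h (Gen.kInv i)
      = gen D h (Gen.kInv i) * (qpow h (((s : ℤ) : ℂ) * (D.d i : ℂ) * (D.A i j : ℂ) / 2) •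
      (gen D h (Gen.X s j) * gen D h (Gen.k i))) * gen D h (Gen.kInv i) := by rw [k_X]
  rw [← mul_assoc, kInv_k, one_mul, mul_smul_comm, smul_mul_assoc, ← mul_assoc,
    mul_assoc _ (gen D h (Gen.k i)), k_kInv, mul_one] at e
  exact e

theorem d_mul_A_symm (i j : ι) : (D.d i : ℂ) * (D.A i j : ℂ) = (D.d j : ℂ) * (D.A j i : ℂ) := by
  have e := D.posDef.isHermitian.apply i j
  simp only [Matrix.of_apply, star_trivial] at e
  exact_mod_cast e.symm

/-- `k_i ⊗ X_i` and `X_j ⊗ k_j⁻¹` commute up to a power of `q`. -/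
theorem swap_mixed (s s' : ℤˣ) (i j : ι) :
    (gen D h (Gen.k i) ⊗ₜ[ℂ] gen D h (Gen.X s i)) * (gen D h (Gen.X s' j) ⊗ₜ gen D h (Gen.kInv j))
      = qpow h ((((s : ℤ) : ℂ) + ((s' : ℤ) : ℂ)) / 2 * ((D.d i : ℂ) * (D.A i j : ℂ))) •
        ((gen D h (Gen.X s' j) ⊗ₜ[ℂ] gen D h (Gen.kInv j)) *
          (gen D h (Gen.k i) ⊗ₜ gen D h (Gen.X s i))) := by
  simp only [Algebra.TensorProduct.tmul_mul_tmul]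
  rw [k_X, X_kInv, ← TensorProduct.smul_tmul', TensorProduct.tmul_smul, smul_smul, ← qpow_add]
  congr 2
  have := d_mul_A_symm D i j
  linear_combination (-((s : ℤ) : ℂ) / 2) * this

theorem swap_terms (s : ℤˣ) (i j : ι) :
    (gen D h (Gen.k i) ⊗ₜ[ℂ] gen D h (Gen.X s i)) * (gen D h (Gen.X s j) ⊗ₜ gen D h (Gen.kInv j))
      = qpow h (((s : ℤ) : ℂ) * (D.d i : ℂ) * (D.A i j : ℂ)) •
        ((gen D h (Gen.X s j) ⊗ₜ[ℂ] gen D h (Gen.kInv j)) *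
          (gen D h (Gen.k i) ⊗ₜ gen D h (Gen.X s i))) := by
  rw [swap_mixed]
  congr 2
  ring

theorem swap_terms' (s : ℤˣ) (i j : ι) :
    (gen D h (Gen.X s i) ⊗ₜ[ℂ] gen D h (Gen.kInv i)) * (gen D h (Gen.k j) ⊗ₜ gen D h (Gen.X s j))
      = qpow h (-(((s : ℤ) : ℂ) * (D.d i : ℂ) * (D.A i j : ℂ))) •
        ((gen D h (Gen.k j) ⊗ₜ[ℂ] gen D h (Gen.X s j)) *
          (gen D h (Gen.X s i) ⊗ₜ gen D h (Gen.kInv i))) := by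
  rw [swap_terms, smul_smul, ← qpow_add]
  have := d_mul_A_symm D i j
  have e : -(((s : ℤ) : ℂ) * (D.d i : ℂ) * (D.A i j : ℂ)) +
      ((s : ℤ) : ℂ) * (D.d j : ℂ) * (D.A j i : ℂ) = 0 := by
    linear_combination (-((s : ℤ) : ℂ)) * this
  rw [e, qpow_zero, one_smul]

theorem comulGen_comm (i j : ι) :
    comulGen D h (Gen.X 1 i) * comulGen D h (Gen.X (-1) j)
        - comulGen D h (Gen.X (-1) j) * comulGen D h (Gen.X 1 i)
      = (gen D h (Gen.X 1 i) * gen D h (Gen.X (-1) j)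
          - gen D h (Gen.X (-1) j) * gen D h (Gen.X 1 i)) ⊗ₜ[ℂ]
            (gen D h (Gen.kInv i) * gen D h (Gen.kInv j))
        + (gen D h (Gen.k i) * gen D h (Gen.k j)) ⊗ₜ[ℂ]
          (gen D h (Gen.X 1 i) * gen D h (Gen.X (-1) j)
          - gen D h (Gen.X (-1) j) * gen D h (Gen.X 1 i)) := by
  have e1 := swap_mixed D h 1 (-1) i j
  have e2 := swap_mixed D h (-1) 1 j i
  have z1 : ((((1 : ℤˣ) : ℤ) : ℂ) + (((-1 : ℤˣ) : ℤ) : ℂ)) / 2 = 0 := by simp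
  have z2 : ((((-1 : ℤˣ) : ℤ) : ℂ) + (((1 : ℤˣ) : ℤ) : ℂ)) / 2 = 0 := by simp
  rw [z1, zero_mul, qpow_zero, one_smul] at e1
  rw [z2, zero_mul, qpow_zero, one_smul] at e2
  simp only [comulGen, mul_add, add_mul, e1, e2]
  simp only [Algebra.TensorProduct.tmul_mul_tmul, TensorProduct.sub_tmul, TensorProduct.tmul_sub]
  rw [kInv_kInv D h j i, k_k D h j i]
  abel

theorem serre_reverse_coeff (i j : ι) (t : ℕ) (ht : t < (1 - D.A i j).toNat) :
    serreCoeff D h i j ((1 - D.A i j).toNat - 1 - t)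
      = qpow h (-((D.d i : ℂ) * ((D.A i j : ℂ) + 2 * (t : ℂ)))) := by
  have e : (((1 - D.A i j).toNat - 1 - t : ℕ) : ℤ) = - D.A i j - t := by omega
  have e' : (((1 - D.A i j).toNat - 1 - t : ℕ) : ℂ) = - (D.A i j : ℂ) - t := by exact_mod_cast e
  rw [serreCoeff, e']
  congr 1
  ring

/-- The Serre element may be computed with the coefficients `q_i ^ (± (a_ij + 2 t))`. -/
theorem serre_sign {B : Type*} [Ring B] [Algebra ℂ B] (s : ℤˣ) (i j : ι) (x y : B) :
    iterComm (serreCoeff D h i j) x y (1 - D.A i j).toNat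
      = iterComm (fun t => qpow h (((s : ℤ) : ℂ) * ((D.d i : ℂ) * ((D.A i j : ℂ) + 2 * (t : ℂ)))))
        x y (1 - D.A i j).toNat := by
  rcases Int.units_eq_one_or s with rfl | rfl
  · exact iterComm_congr _ _ _ fun t _ => by simp [serreCoeff]
  · rw [iterComm_reverse]
    exact iterComm_congr _ _ _ fun t ht => by simp [serre_reverse_coeff D h i j t ht]

theorem serre_comul (s : ℤˣ) (i j : ι) (hij : i ≠ j) :
    iterComm (serreCoeff D h i j) (comulGen D h (Gen.X s i)) (comulGen D h (Gen.X s j))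
      (1 - D.A i j).toNat = 0 := by
  have hii : (D.A i i : ℂ) = 2 := by exact_mod_cast D.diag i
  simp only [comulGen, iterComm_add]
  have p1 : iterComm (serreCoeff D h i j)
      (gen D h (Gen.X s i) ⊗ₜ[ℂ] gen D h (Gen.kInv i) + gen D h (Gen.k i) ⊗ₜ gen D h (Gen.X s i))
      (gen D h (Gen.X s j) ⊗ₜ gen D h (Gen.kInv j)) (1 - D.A i j).toNat = 0 := by
    rw [serre_sign D h s, (iterComm_split _
      (qpow h (((s : ℤ) : ℂ) * (D.d i : ℂ) * 2)) ?_ _ _ _ ?_ ?_ _).1, ← serre_sign D h s,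
      iterComm_tmul _ _ _ _ _ (kInv_kInv D h i j), serre D h s i j hij, TensorProduct.zero_tmul]
    · intro t
      rw [← qpow_add]; congr 1; push_cast; ring
    · rw [swap_terms, hii]
    · rw [swap_terms]; congr 2; push_cast; ring
  have p2 : iterComm (serreCoeff D h i j)
      (gen D h (Gen.X s i) ⊗ₜ[ℂ] gen D h (Gen.kInv i) + gen D h (Gen.k i) ⊗ₜ gen D h (Gen.X s i))
      (gen D h (Gen.k j) ⊗ₜ gen D h (Gen.X s j)) (1 - D.A i j).toNat = 0 := by
    rw [add_comm, serre_sign D h (-s), (iterComm_split _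
      (qpow h (-(((s : ℤ) : ℂ) * (D.d i : ℂ) * 2))) ?_ _ _ _ ?_ ?_ _).1, ← serre_sign D h (-s),
      iterComm_tmul' _ _ _ _ _ (k_k D h i j), serre D h s i j hij, TensorProduct.tmul_zero]
    · intro t
      rw [← qpow_add]; congr 1; push_cast; ring
    · rw [swap_terms', hii]
    · rw [swap_terms']; congr 2; push_cast; ring
  rw [p1, p2, add_zero]

theorem comul_rel ⦃a b : FreeAlgebra ℂ (Gen ι)⦄ (hab : Rel D h a b) :
    FreeAlgebra.lift ℂ (comulGen D h) a = FreeAlgebra.lift ℂ (comulGen D h) b := by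
  cases hab with
  | k_kInv i => simp [comulGen, k_kInv, Algebra.TensorProduct.one_def]
  | kInv_k i => simp [comulGen, kInv_k, Algebra.TensorProduct.one_def]
  | k_k i j => simp [comulGen, k_k D h i j]
  | k_X s i j =>
    have hk : gen D h (Gen.k i) * gen D h (Gen.kInv j)
        = gen D h (Gen.kInv j) * gen D h (Gen.k i) := by
      let u (i : ι) : (Uq D h)ˣ :=
        ⟨gen D h (Gen.k i), gen D h (Gen.kInv i), k_kInv D h i, kInv_k D h i⟩
      have e' : Commute (u i : Uq D h) (u j) := k_k D h i j
      exact e'.units_inv_right.eq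
    simp [comulGen, mul_add, add_mul, k_X D h s i j, hk, k_k D h i j, TensorProduct.smul_tmul']
  | X_X_same i =>
    simp only [map_sub, map_mul, map_smul, map_pow, FreeAlgebra.lift_ι_apply]
    rw [comulGen_comm, X_X_same]
    simp only [comulGen, pow_two, TensorProduct.sub_tmul, TensorProduct.tmul_sub,
      TensorProduct.tmul_smul, ← TensorProduct.smul_tmul', ← smul_add,
      Algebra.TensorProduct.tmul_mul_tmul]
    congr 1
    abel
  | X_X_ne i j hij =>
    simp only [map_mul, FreeAlgebra.lift_ι_apply]
    rw [← sub_eq_zero, comulGen_comm, X_X_ne D h i j hij]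
    simp
  | serre s i j hij =>
    rw [map_iterComm, map_zero]
    simpa using serre_comul D h s i j hij

end relations

/-- The coproduct `Δ : U_q(g) → U_q(g) ⊗ U_q(g)`. -/
def comul (D : CartanDatum ι) (h : ℂ) : Uq D h →ₐ[ℂ] Uq D h ⊗[ℂ] Uq D h :=
  RingQuot.liftAlgHom ℂ ⟨FreeAlgebra.lift ℂ (comulGen D h), comul_rel D h⟩

theorem comul_gen (D : CartanDatum ι) (h : ℂ) (g : Gen ι) :
    comul D h (gen D h g) = comulGen D h g := by
  simp only [comul, gen, mk]
  erw [RingQuot.liftAlgHom_mkAlgHom_apply]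
  simp

/-- The opposite coproduct `Δ' = σ ∘ Δ`. -/
def comulOp (D : CartanDatum ι) (h : ℂ) : Uq D h →ₐ[ℂ] Uq D h ⊗[ℂ] Uq D h :=
  (Algebra.TensorProduct.comm ℂ (Uq D h) (Uq D h)).toAlgHom.comp (comul D h)

/-! ### Representations -/

/-- Weight spaces. A weight `w` is given by its values `w i` on the simple coroots, and
`k i = q ^ (H_i)` acts on the weight space by `q ^ (d i * w i / 2)`. -/
def weightSpace {D : CartanDatum ι} {h : ℂ} {V : Type*} [AddCommGroup V] [Module ℂ V]
    (ρ : Uq D h →ₐ[ℂ] Module.End ℂ V) (w : ι → ℤ) : Submodule ℂ V :=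
  ⨅ i, LinearMap.ker (ρ (gen D h (Gen.k i)) - qpow h ((D.d i : ℂ) * (w i : ℂ) / 2) • 1)

theorem mem_weightSpace {D : CartanDatum ι} {h : ℂ} {V : Type*} [AddCommGroup V] [Module ℂ V]
    (ρ : Uq D h →ₐ[ℂ] Module.End ℂ V) (w : ι → ℤ) (v : V) : v ∈ weightSpace ρ w ↔
      ∀ i, ρ (gen D h (Gen.k i)) v = qpow h ((D.d i : ℂ) * (w i : ℂ) / 2) • v := by
  simp [weightSpace, sub_eq_zero]

/-- Finite dimensional representations of `U_q(g)` in which the `H_i` are diagonalisable with the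
eigenvalues of an integral weight (representations of type 1). -/
structure QRep (D : CartanDatum ι) (h : ℂ) where
  carrier : Type
  [addCommGroup : AddCommGroup carrier]
  [module : Module ℂ carrier]
  [finite : Module.Finite ℂ carrier]
  ρ : Uq D h →ₐ[ℂ] Module.End ℂ carrier
  weights : ⨆ w, weightSpace ρ w = ⊤

attribute [instance] QRep.addCommGroup QRep.module QRep.finite

variable {D : CartanDatum ι} {h : ℂ}

namespace QRep

/-- `ρ^V ⊗ ρ^W` as a representation of `U_q(g) ⊗ U_q(g)`. -/
def act₂ (V W : QRep D h) :
    Uq D h ⊗[ℂ] Uq D h →ₐ[ℂ] Module.End ℂ (V.carrier ⊗[ℂ] W.carrier) :=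
  (Module.endTensorEndAlgHom (R := ℂ) (S := ℂ) (A := ℂ)).comp (Algebra.TensorProduct.map V.ρ W.ρ)

theorem act₂_tmul (V W : QRep D h) (a b : Uq D h) (v : V.carrier) (w : W.carrier) :
    V.act₂ W (a ⊗ₜ b) (v ⊗ₜ w) = V.ρ a v ⊗ₜ W.ρ b w := by
  simp [act₂, Module.endTensorEndAlgHom_apply]

/-- The tensor product of two subspaces, as a subspace of `V ⊗ W`. -/
def tensorSub {V W : QRep D h} (S : Submodule ℂ V.carrier) (T : Submodule ℂ W.carrier) :
    Submodule ℂ (V.carrier ⊗[ℂ] W.carrier) :=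
  Submodule.map₂ (TensorProduct.mk ℂ V.carrier W.carrier) S T

theorem tensorSub_le (V W : QRep D h) (a b : ι → ℤ) :
    tensorSub (weightSpace V.ρ a) (weightSpace W.ρ b)
      ≤ weightSpace ((V.act₂ W).comp (comul D h)) (a + b) := by
  refine Submodule.map₂_le.2 fun v hv w hw => ?_
  rw [mem_weightSpace] at hv hw ⊢
  intro i
  rw [AlgHom.comp_apply, comul_gen, comulGen, TensorProduct.mk_apply, act₂_tmul, hv, hw,
    ← TensorProduct.smul_tmul', TensorProduct.tmul_smul, smul_smul, ← qpow_add]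
  congr 2
  simp only [Pi.add_apply]
  push_cast
  ring

/-- The tensor product of representations, `(ρ^V ⊗ ρ^W) ∘ Δ`. -/
def tensor (V W : QRep D h) : QRep D h where
  carrier := V.carrier ⊗[ℂ] W.carrier
  ρ := (V.act₂ W).comp (comul D h)
  weights := by
    rw [eq_top_iff, ← TensorProduct.map₂_mk_top_top_eq_top, ← V.weights, ← W.weights,
      Submodule.map₂_iSup_left]
    refine iSup_le fun a => ?_
    rw [Submodule.map₂_iSup_right]
    exact iSup_le fun b => (tensorSub_le V W a b).trans (le_iSup _ (a + b))

/-- `f` commutes with the action of the quantum algebra. -/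
def IsIntertwiner (V W : QRep D h) (f : V.carrier →ₗ[ℂ] W.carrier) : Prop :=
  ∀ ξ : Uq D h, f ∘ₗ V.ρ ξ = W.ρ ξ ∘ₗ f

/-- Equivalence of representations. -/
def Equivalent (V W : QRep D h) : Prop :=
  ∃ f : V.carrier ≃ₗ[ℂ] W.carrier, IsIntertwiner V W f

/-- Irreducible representations. -/
def IsIrreducible (V : QRep D h) : Prop :=
  Nontrivial V.carrier ∧ ∀ S : Submodule ℂ V.carrier,
    (∀ ξ : Uq D h, ∀ v ∈ S, V.ρ ξ v ∈ S) → S = ⊥ ∨ S = ⊤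

end QRep

open QRep

/-! ### The universal `R`-matrix -/

/-- The invariant form on weights, `(α_i, α_j) = d i * A i j`, in terms of the values of the weights
on the simple coroots. -/
def weightForm (D : CartanDatum ι) (a b : ι → ℤ) : ℂ :=
  ∑ i, (D.d i : ℂ) * (a i : ℂ) *
    ((D.A.map (Int.cast : ℤ → ℂ))⁻¹.mulVec fun j => (b j : ℂ)) i

/-- Acting by `f` in the factors `1, 2` of `V₁ ⊗ (V₂ ⊗ V₃)`. -/
def op12 {V₁ V₂ : Type*} (V₃ : Type*) [AddCommGroup V₁] [Module ℂ V₁] [AddCommGroup V₂]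
    [Module ℂ V₂] [AddCommGroup V₃] [Module ℂ V₃] (f : Module.End ℂ (V₁ ⊗[ℂ] V₂)) :
    Module.End ℂ (V₁ ⊗[ℂ] (V₂ ⊗[ℂ] V₃)) :=
  (TensorProduct.assoc ℂ V₁ V₂ V₃).conj (f.rTensor V₃)

/-- Acting by `f` in the factors `1, 3` of `V₁ ⊗ (V₂ ⊗ V₃)`. -/
def op13 {V₁ V₃ : Type*} (V₂ : Type*) [AddCommGroup V₁] [Module ℂ V₁] [AddCommGroup V₂]
    [Module ℂ V₂] [AddCommGroup V₃] [Module ℂ V₃] (f : Module.End ℂ (V₁ ⊗[ℂ] V₃)) :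
    Module.End ℂ (V₁ ⊗[ℂ] (V₂ ⊗[ℂ] V₃)) :=
  (TensorProduct.leftComm ℂ V₂ V₁ V₃).conj (f.lTensor V₂)

/-- Acting by `f` in the factors `2, 3` of `V₁ ⊗ (V₂ ⊗ V₃)`. -/
def op23 {V₂ V₃ : Type*} (V₁ : Type*) [AddCommGroup V₁] [Module ℂ V₁] [AddCommGroup V₂]
    [Module ℂ V₂] [AddCommGroup V₃] [Module ℂ V₃] (f : Module.End ℂ (V₂ ⊗[ℂ] V₃)) :
    Module.End ℂ (V₁ ⊗[ℂ] (V₂ ⊗[ℂ] V₃)) :=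
  f.lTensor V₁

/-- The universal `R`-matrix of `U_q(g)`. It is an element of the completion of `U_q(g) ⊗ U_q(g)`
whose elements are the families of operators on the spaces `V ⊗ W`, natural in the representations
`V` and `W`. -/
structure UniversalRMatrix (D : CartanDatum ι) (h : ℂ) where
  /-- `(ρ^V ⊗ ρ^W) R`, an invertible operator. -/
  R : ∀ V W : QRep D h, (V.carrier ⊗[ℂ] W.carrier) ≃ₗ[ℂ] (V.carrier ⊗[ℂ] W.carrier)
  natural : ∀ (V V' W W' : QRep D h) (f : V.carrier →ₗ[ℂ] V'.carrier)
    (g : W.carrier →ₗ[ℂ] W'.carrier), IsIntertwiner V V' f → IsIntertwiner W W' g →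
      (R V' W').toLinearMap ∘ₗ TensorProduct.map f g
        = TensorProduct.map f g ∘ₗ (R V W).toLinearMap
  /-- `R Δ(ξ) = Δ'(ξ) R`. -/
  quasiCocomm : ∀ (V W : QRep D h) (ξ : Uq D h),
    (R V W).toLinearMap ∘ₗ V.act₂ W (comul D h ξ) = V.act₂ W (comulOp D h ξ) ∘ₗ (R V W).toLinearMap
  /-- `(id ⊗ Δ) R = R₁₃ R₁₂`. -/
  id_comul : ∀ V W X : QRep D h,
    (R V (W.tensor X)).toLinearMap
      = op13 W.carrier (R V X).toLinearMap * op12 X.carrier (R V W).toLinearMap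
  /-- `(Δ ⊗ id) R = R₁₃ R₂₃`. -/
  comul_id : ∀ V W X : QRep D h,
    (TensorProduct.assoc ℂ V.carrier W.carrier X.carrier).conj (R (V.tensor W) X).toLinearMap
      = op13 W.carrier (R V X).toLinearMap * op23 V.carrier (R W X).toLinearMap
  /-- `R = q ^ (∑ ⟨H, H⟩) (1 + terms of weight (-β, β) with β > 0)`: on vectors of weights `a` and `b`
  it is multiplication by `q ^ (a, b)`, up to terms of weights `a - β` and `b + β`, where `β ≠ 0`
  runs through the sums of simple roots. -/
  leading : ∀ (V W : QRep D h) (a b : ι → ℤ), ∀ v ∈ weightSpace V.ρ a, ∀ w ∈ weightSpace W.ρ b,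
    R V W (v ⊗ₜ w) - qpow h (weightForm D a b) • (v ⊗ₜ[ℂ] w) ∈
      ⨆ β : {β : ι → ℕ // β ≠ 0},
        tensorSub (weightSpace V.ρ (a - D.A.mulVec fun j => (β.1 j : ℤ)))
          (weightSpace W.ρ (b + D.A.mulVec fun j => (β.1 j : ℤ)))

namespace UniversalRMatrix

/-- `R_+ = (ρ^V ⊗ ρ^W) R`. -/
def plus (𝓡 : UniversalRMatrix D h) (V W : QRep D h) :
    Module.End ℂ (V.carrier ⊗[ℂ] W.carrier) :=
  (𝓡.R V W).toLinearMap

/-- `R_- = (ρ^V ⊗ ρ^W) (R')⁻¹`, where `R' = σ(R)`. -/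
def minus (𝓡 : UniversalRMatrix D h) (V W : QRep D h) :
    Module.End ℂ (V.carrier ⊗[ℂ] W.carrier) :=
  (TensorProduct.comm ℂ W.carrier V.carrier).conj (𝓡.R W V).symm.toLinearMap

end UniversalRMatrix

/-! ### The model space, tensor operators, and Clebsch-Gordan maps -/

/-- `irr` lists the irreducible representations, one from every equivalence class. -/
structure IsIrrepList {Λ : Type*} (irr : Λ → QRep D h) : Prop where
  irreducible : ∀ K, (irr K).IsIrreducible
  inequivalent : ∀ K L, Equivalent (irr K) (irr L) → K = L
  exhaustive : ∀ V : QRep D h, V.IsIrreducible → ∃ K, Equivalent V (irr K)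

/-- The model space: the direct sum of the irreducible representations with multiplicity one. -/
abbrev ModelSpace {Λ : Type*} (irr : Λ → QRep D h) : Type _ := ⨁ K, (irr K).carrier

/-- The operator `(ρ^V ⊗ id) R` on `V ⊗ M`, `M` the model space: an element of the completed algebra
acts on every summand of `M` through the corresponding irreducible representation. Used for
`R = R_±(V, ·)`, this is the `L`-operator `L_±`. -/
def lOp {Λ : Type*} [DecidableEq Λ] (irr : Λ → QRep D h) (V : QRep D h)
    (R : ∀ W : QRep D h, Module.End ℂ (V.carrier ⊗[ℂ] W.carrier)) :
    Module.End ℂ (V.carrier ⊗[ℂ] ModelSpace irr) :=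
  (TensorProduct.directSumRight ℂ ℂ V.carrier fun K => (irr K).carrier).symm.conj
    (DirectSum.lmap fun K => R (irr K))

/-- The row `U = (T_1, …, T_n)` of operators on `M`, as the map `V ⊗ M → M`,
`e_m ⊗ x ↦ T_m x`. -/
def row {n : ℕ} {V M : Type*} [AddCommGroup V] [Module ℂ V] [AddCommGroup M] [Module ℂ M]
    (e : Module.Basis (Fin n) ℂ V) (T : Fin n → Module.End ℂ M) : V ⊗[ℂ] M →ₗ[ℂ] M :=
  TensorProduct.lift (e.constr ℂ T)

/-- The relation `L₁ U₂ = U₂ R₁₂ L₁` between maps `V₀ ⊗ (V ⊗ M) → V₀ ⊗ M`. -/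
def ExchangeRelation {V₀ V M : Type*} [AddCommGroup V₀] [Module ℂ V₀] [AddCommGroup V] [Module ℂ V]
    [AddCommGroup M] [Module ℂ M] (L : Module.End ℂ (V₀ ⊗[ℂ] M)) (R : Module.End ℂ (V₀ ⊗[ℂ] V))
    (U : V ⊗[ℂ] M →ₗ[ℂ] M) : Prop :=
  L ∘ₗ U.lTensor V₀ = U.lTensor V₀ ∘ₗ op12 M R ∘ₗ op13 V L

/-- `T_1, …, T_n` is a `q`-tensor operator on the model space, transforming by the representation
`J` with basis `e`: the row `U` that it forms satisfies the relations
`L_±^{I₀} U = U R_±^{I₀ J} L_±^{I₀}`. -/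
def IsTensorOperator {Λ : Type*} [DecidableEq Λ] (𝓡 : UniversalRMatrix D h) (irr : Λ → QRep D h)
    (I₀ J : QRep D h) {n : ℕ} (e : Module.Basis (Fin n) ℂ J.carrier)
    (T : Fin n → Module.End ℂ (ModelSpace irr)) : Prop :=
  ExchangeRelation (lOp irr I₀ (𝓡.plus I₀)) (𝓡.plus I₀ J) (row e T) ∧
    ExchangeRelation (lOp irr I₀ (𝓡.minus I₀)) (𝓡.minus I₀ J) (row e T)

/-- A system of Clebsch-Gordan maps `C[IJK] : V^I ⊗ V^J → V^K`, `C'[IJK] : V^K → V^I ⊗ V^J` for the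
decomposition of `V^I ⊗ V^J` into irreducible representations. If `V^K` occurs more than once, its
copies are numbered by `a = 0, …, mult K - 1`. -/
structure ClebschGordan {Λ : Type*} (irr : Λ → QRep D h) (I J : QRep D h) where
  mult : Λ → ℕ
  support : Finset Λ
  mem_support : ∀ K, K ∈ support ↔ mult K ≠ 0
  C : ∀ K, Fin (mult K) → (I.carrier ⊗[ℂ] J.carrier →ₗ[ℂ] (irr K).carrier)
  C' : ∀ K, Fin (mult K) → ((irr K).carrier →ₗ[ℂ] I.carrier ⊗[ℂ] J.carrier)
  intertwines : ∀ K a (ξ : Uq D h), C K a ∘ₗ I.act₂ J (comul D h ξ) = (irr K).ρ ξ ∘ₗ C K a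
  intertwines' : ∀ K a (ξ : Uq D h), I.act₂ J (comul D h ξ) ∘ₗ C' K a = C' K a ∘ₗ (irr K).ρ ξ
  complete : ∑ K ∈ support, ∑ a, C' K a ∘ₗ C K a = LinearMap.id
  orthogonal_same : ∀ K a, C K a ∘ₗ C' K a = LinearMap.id
  orthogonal_mult : ∀ K a b, a ≠ b → C K a ∘ₗ C' K b = 0
  orthogonal_ne : ∀ K L a b, K ≠ L → C K a ∘ₗ C' L b = 0

/-- The Clebsch-Gordan coefficient `{I J K; m' m m''}`: the entry of the matrix of `C[IJK]` in the
given bases. -/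
def ClebschGordan.coeff {Λ : Type*} {irr : Λ → QRep D h} {I J : QRep D h}
    (cg : ClebschGordan irr I J) {nI nJ : ℕ} {n : Λ → ℕ} (eI : Module.Basis (Fin nI) ℂ I.carrier)
    (eJ : Module.Basis (Fin nJ) ℂ J.carrier) (e : ∀ K, Module.Basis (Fin (n K)) ℂ (irr K).carrier)
    (K : Λ) (a : Fin (cg.mult K)) (m' : Fin nI) (m : Fin nJ) (m'' : Fin (n K)) : ℂ :=
  (e K).repr (cg.C K a (eI m' ⊗ₜ eJ m)) m''

/-- The basis vector `|K m⟩` of the model space. -/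
def ket {Λ : Type*} [DecidableEq Λ] {irr : Λ → QRep D h} {n : Λ → ℕ}
    (e : ∀ K, Module.Basis (Fin (n K)) ℂ (irr K).carrier) (K : Λ) (m : Fin (n K)) :
    ModelSpace irr :=
  DirectSum.lof ℂ Λ (fun K => (irr K).carrier) K (e K m)

/-- The matrix element `⟨K m''| X |I m'⟩` in the basis of the vectors `|K m⟩`. -/
def matrixElement {Λ : Type*} [DecidableEq Λ] {irr : Λ → QRep D h} {n : Λ → ℕ}
    (e : ∀ K, Module.Basis (Fin (n K)) ℂ (irr K).carrier) (X : Module.End ℂ (ModelSpace irr))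
    (K : Λ) (m'' : Fin (n K)) (I : Λ) (m' : Fin (n I)) : ℂ :=
  (e K).repr (X (ket e I m') K) m''

end QG

end

noncomputable section

namespace QG

open QRep

variable {ι : Type*} [Fintype ι] [DecidableEq ι] {D : CartanDatum ι} {h : ℂ}

/-! ### Powers of `q` -/

/-! The theorem reduces to Schur's lemma once each component `V^I ⊗ V^J → V^K` of the row `U` is
known to intertwine the action of the quantum algebra; its expansion in the Clebsch-Gordan maps then
has the reduced matrix elements as coefficients (`ClebschGordan.exists_eq_sum`).

The `L`-operators are block diagonal on the model space, so the exchange relations split into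
relations for the components. In these the product `R₁₃ R₁₂` appears. By `(id ⊗ Δ) R = R₁₃ R₁₂` for
`R_+`, and by the inverted and flipped `(Δ ⊗ id) R = R₁₃ R₂₃` for `R_-`, it equals `R_±(I₀, V^I ⊗
V^J)`. Hence a component `f` commutes with `R(I₀, ·)` and with `R(·, I₀)`.

The main point, `isIntertwiner_of_commutes`, is that this forces `f` to commute with every
generator. A diagonal block of `R(I₀, ·)` at a weight `a` of `I₀` acts as `q ^ (a, ·)`. Two weights
of `I₀` differing by `α_i` therefore give `k_i ^ 2`, and so `f` preserves weights. For `X_i^±` let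
`δ = X f - f X`. Subtracting the relations `R Δ(X) = Δ'(X) R` for source and target leaves `R (k_i ⊗
δ) = (k_i⁻¹ ⊗ δ) R` and its mirror image. On leading terms the two sides differ by a factor `q ^ (±
2 d_i a_i)`, so `δ = 0` as soon as `a_i ≠ 0`. Here `R(I₀, ·)` serves `X_i^+` and `R(·, I₀)` serves
`X_i^-`.

Suitable weights exist for every `i` because `I₀` is irreducible of dimension above one and the
Cartan matrix is indecomposable (`exists_weight_add_root`). -/

theorem qpow_ne_zero (h x : ℂ) : qpow h x ≠ 0 := Complex.exp_ne_zero _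

/-- Half-integral exponents occur because `k_i` acts by `q ^ (d_i w_i / 2)`. Squaring makes the
exponent integral, where the assumption on `q` applies. -/
theorem qpow_half_eq_one (hq : ∀ r : ℕ, 0 < r → Complex.exp h ^ r ≠ 1) {n : ℤ}
    (hn : qpow h ((n : ℂ) / 2) = 1) : n = 0 := by
  have h1 : Complex.exp h ^ n = 1 := by
    rw [← Complex.exp_int_mul]
    have : (n : ℂ) * h = h * (n / 2) + h * (n / 2) := by ring
    rw [this, Complex.exp_add]
    change qpow h _ * qpow h _ = 1
    rw [hn, one_mul]
  by_contra hne
  refine hq n.natAbs (Int.natAbs_pos.2 hne) ?_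
  rcases Int.natAbs_eq n with e | e
  · rw [e, zpow_natCast] at h1; simpa using h1
  · rw [e, zpow_neg, zpow_natCast, inv_eq_one] at h1; simpa using h1

theorem qpow_half_injective (hq : ∀ r : ℕ, 0 < r → Complex.exp h ^ r ≠ 1) {m n : ℤ}
    (hmn : qpow h ((m : ℂ) / 2) = qpow h ((n : ℂ) / 2)) : m = n := by
  refine sub_eq_zero.1 (qpow_half_eq_one hq ?_)
  have e : (((m - n : ℤ) : ℂ) / 2) + (n : ℂ) / 2 = (m : ℂ) / 2 := by push_cast; ring
  apply mul_right_cancel₀ (qpow_ne_zero h ((n : ℂ) / 2))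
  rw [← qpow_add, e, hmn, one_mul]

theorem eq_zero_of_qpow_eq (hq : ∀ r : ℕ, 0 < r → Complex.exp h ^ r ≠ 1) {x y : ℂ} {n : ℤ}
    (hxy : qpow h x = qpow h y) (hn : x = y + (n : ℂ) / 2) : n = 0 := by
  refine qpow_half_eq_one hq (mul_left_cancel₀ (qpow_ne_zero h y) ?_)
  rw [← qpow_add, ← hn, hxy, mul_one]

/-! ### The root lattice and the invariant form -/

/-- The simple root `α_i`, as a weight. -/
def CartanDatum.root (D : CartanDatum ι) (i : ι) : ι → ℤ := fun j => D.A j i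

/-- The symmetrised matrix is positive definite and equals a diagonal matrix times `A`, so `det A`
cannot vanish. Nonvanishing passes from `ℝ` to `ℂ` through the integer determinant. -/
theorem CartanDatum.isUnit_det (D : CartanDatum ι) :
    IsUnit (D.A.map (Int.cast : ℤ → ℂ)).det := by
  have h1 := D.posDef.det_pos
  have h2 : (Matrix.of fun i j => (D.d i : ℝ) * (D.A i j : ℝ))
      = Matrix.diagonal (fun i => (D.d i : ℝ)) * D.A.map (Int.cast : ℤ → ℝ) := by
    ext i j; simp [Matrix.diagonal_mul]
  rw [h2, Matrix.det_mul] at h1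
  have h3 : (D.A.map (Int.cast : ℤ → ℝ)).det ≠ 0 := fun e => by simp [e] at h1
  have h4 : D.A.det ≠ 0 := by
    intro e
    apply h3
    have := (Int.castRingHom ℝ).map_det D.A
    rw [e] at this
    simpa using this.symm
  rw [isUnit_iff_ne_zero]
  have := (Int.castRingHom ℂ).map_det D.A
  change _ = (D.A.map (Int.cast : ℤ → ℂ)).det at this
  rw [← this]
  simpa using h4

theorem CartanDatum.mulVec_injective (D : CartanDatum ι) {b : ι → ℤ} (hb : D.A.mulVec b = 0) :
    b = 0 := by
  have hd : D.A.det ≠ 0 := by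
    intro e
    have := (Int.castRingHom ℂ).map_det D.A
    rw [e] at this
    exact D.isUnit_det.ne_zero (by simpa using this.symm)
  exact Matrix.eq_zero_of_mulVec_eq_zero hd hb

theorem inv_mulVec_root (D : CartanDatum ι) (i : ι) :
    ((D.A.map (Int.cast : ℤ → ℂ))⁻¹.mulVec fun j => (D.root i j : ℂ)) = Pi.single i 1 := by
  have e : (fun j => (D.root i j : ℂ)) = (D.A.map (Int.cast : ℤ → ℂ)).mulVec (Pi.single i 1) := by
    ext j; simp [CartanDatum.root]
  rw [e, Matrix.mulVec_mulVec, Matrix.nonsing_inv_mul _ D.isUnit_det, Matrix.one_mulVec]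

theorem weightForm_add_right (a b c : ι → ℤ) :
    weightForm D a (b + c) = weightForm D a b + weightForm D a c := by
  have e : (fun j => ((b + c) j : ℂ)) = (fun j => (b j : ℂ)) + fun j => (c j : ℂ) := by
    ext j; simp
  simp only [weightForm]
  rw [e, Matrix.mulVec_add]
  simp only [Pi.add_apply, mul_add, Finset.sum_add_distrib]

theorem weightForm_add_left (a b c : ι → ℤ) :
    weightForm D (a + b) c = weightForm D a c + weightForm D b c := by
  simp only [weightForm, Pi.add_apply, ← Finset.sum_add_distrib]
  refine Finset.sum_congr rfl fun i _ => ?_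
  push_cast; ring

theorem weightForm_root_right (a : ι → ℤ) (i : ι) :
    weightForm D a (D.root i) = (D.d i : ℂ) * (a i : ℂ) := by
  rw [weightForm, inv_mulVec_root]
  simp [Pi.single_apply]

theorem weightForm_root_left (b : ι → ℤ) (i : ι) :
    weightForm D (D.root i) b = (D.d i : ℂ) * (b i : ℂ) := by
  have e : ∀ j, (D.d j : ℂ) * (D.root i j : ℂ) = (D.d i : ℂ) * (D.A.map (Int.cast : ℤ → ℂ)) i j :=
    fun j => by simpa [CartanDatum.root] using d_mul_A_symm D j i
  simp only [weightForm, e, mul_assoc, ← Finset.mul_sum]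
  congr 1
  change ((D.A.map (Int.cast : ℤ → ℂ)).mulVec _) i = _
  rw [Matrix.mulVec_mulVec, Matrix.mul_nonsing_inv _ D.isUnit_det, Matrix.one_mulVec]

/-! ### Weight spaces -/

section weights

variable {V : Type*} [AddCommGroup V] [Module ℂ V] (ρ : Uq D h →ₐ[ℂ] Module.End ℂ V)

/-- Joint eigenspaces of the commuting operators `k_i` are independent for distinct systems of
eigenvalues, and distinct weights give distinct systems since `q` is not a root of unity. -/
theorem weightSpace_iSupIndep (hq : ∀ r : ℕ, 0 < r → Complex.exp h ^ r ≠ 1) :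
    iSupIndep (weightSpace ρ) := by
  have h1 := Module.End.independent_iInf_maxGenEigenspace_of_forall_mapsTo
    (fun i => ρ (gen D h (Gen.k i))) (fun i j φ => Module.End.mapsTo_maxGenEigenspace_of_comm
      (by change _ * _ = _ * _; rw [← map_mul, k_k, map_mul]) φ)
  have hinj : Function.Injective fun (w : ι → ℤ) (i : ι) =>
      qpow h ((D.d i : ℂ) * (w i : ℂ) / 2) := by
    intro w w' hw
    ext i
    have := congrFun hw i
    have := qpow_half_injective hq (m := D.d i * w i) (n := D.d i * w' i) (by exact_mod_cast this)
    exact mul_left_cancel₀ (by exact_mod_cast (D.d_pos i).ne') this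
  refine (h1.comp hinj).mono fun w => ?_
  refine iInf_mono fun i => ?_
  refine le_trans (le_of_eq ?_) (Module.End.genEigenspace_le_maximal _ _ 1)
  rw [Nat.cast_one, Module.End.genEigenspace_one]

/-- Contraction with such a functional cuts a diagonal block out of the `R`-matrix and discards the
terms of shifted weight. -/
theorem exists_weight_functional (hq : ∀ r : ℕ, 0 < r → Complex.exp h ^ r ≠ 1) {a : ι → ℤ} {v : V}
    (hv : v ∈ weightSpace ρ a) (hv0 : v ≠ 0) :
    ∃ φ : V →ₗ[ℂ] ℂ, φ v = 1 ∧ ∀ c ≠ a, ∀ w ∈ weightSpace ρ c, φ w = 0 := by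
  have hd := weightSpace_iSupIndep ρ hq a
  obtain ⟨f, hf, hf'⟩ := Submodule.exists_le_ker_of_notMem
    (p := ⨆ c, ⨆ (_ : c ≠ a), weightSpace ρ c) (v := v)
    fun hmem => hv0 (Submodule.disjoint_def.1 hd v hv hmem)
  refine ⟨(f v)⁻¹ • f, by simp [hf], fun c hc w hw => ?_⟩
  have : f w = 0 := hf' (Submodule.mem_iSup_of_mem c (Submodule.mem_iSup_of_mem hc hw))
  simp [this]

theorem kInv_weight {a : ι → ℤ} {v : V} (hv : v ∈ weightSpace ρ a) (i : ι) :
    ρ (gen D h (Gen.kInv i)) v = qpow h (-((D.d i : ℂ) * (a i : ℂ) / 2)) • v := by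
  have e := congrArg (fun x => ρ x v) (kInv_k D h i)
  simp only [map_mul, map_one, Module.End.mul_apply, Module.End.one_apply,
    (mem_weightSpace ρ a v).1 hv i, map_smul] at e
  rw [← e, smul_smul, ← qpow_add, e, neg_add_cancel, qpow_zero, one_smul]

theorem X_weight (s : ℤˣ) (i : ι) {a : ι → ℤ} {v : V} (hv : v ∈ weightSpace ρ a) :
    ρ (gen D h (Gen.X s i)) v ∈ weightSpace ρ (a + (s : ℤ) • D.root i) := by
  rw [mem_weightSpace] at hv ⊢
  intro j
  have e := congrArg (fun x => ρ x v) (k_X D h s j i)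
  simp only [map_mul, map_smul, Module.End.mul_apply, LinearMap.smul_apply, hv j, smul_smul,
    ← qpow_add] at e
  rw [e]
  congr 2
  simp only [CartanDatum.root, Pi.add_apply, Pi.smul_apply, smul_eq_mul]
  push_cast; ring

/-- An operator that acts on every weight space by a nonzero scalar is injective. -/
theorem eq_zero_of_weight_scalar [Module.Finite ℂ V] (hρ : ⨆ w, weightSpace ρ w = ⊤)
    (g : Module.End ℂ V) (s : (ι → ℤ) → ℂ) (hs : ∀ c, s c ≠ 0)
    (hg : ∀ c, ∀ v ∈ weightSpace ρ c, g v = s c • v) {v : V} (hv : g v = 0) : v = 0 := by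
  have hsurj : Function.Surjective g := by
    rw [← LinearMap.range_eq_top, eq_top_iff, ← hρ]
    refine iSup_le fun c w hw => ⟨(s c)⁻¹ • w, ?_⟩
    rw [map_smul, hg c w hw, smul_smul, inv_mul_cancel₀ (hs c), one_smul]
  exact LinearMap.injective_iff_surjective.2 hsurj (by simpa using hv)

theorem ext_weightSpace (hρ : ⨆ w, weightSpace ρ w = ⊤) {W : Type*} [AddCommGroup W] [Module ℂ W]
    {f g : V →ₗ[ℂ] W} (hfg : ∀ c, ∀ v ∈ weightSpace ρ c, f v = g v) : f = g := by
  have : ⊤ ≤ LinearMap.eqLocus f g := by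
    rw [← hρ]
    exact iSup_le fun c v hv => hfg c v hv
  exact LinearMap.ext fun v => this trivial

/-- The eigenvectors of `k_i ^ 2` are eigenvectors of `k_i`. -/
theorem k_eq_of_sq_eq (hq : ∀ r : ℕ, 0 < r → Complex.exp h ^ r ≠ 1) [Module.Finite ℂ V]
    (hρ : ⨆ w, weightSpace ρ w = ⊤) (i : ι) (n : ℤ) {v : V}
    (hv : ρ (gen D h (Gen.k i)) (ρ (gen D h (Gen.k i)) v) = qpow h ((D.d i : ℂ) * (n : ℂ)) • v) :
    ρ (gen D h (Gen.k i)) v = qpow h ((D.d i : ℂ) * (n : ℂ) / 2) • v := by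
  set K := ρ (gen D h (Gen.k i))
  set c := qpow h ((D.d i : ℂ) * (n : ℂ) / 2)
  have hcc : qpow h ((D.d i : ℂ) * (n : ℂ)) = c * c := by
    rw [← qpow_add]; congr 1; ring
  rw [hcc] at hv
  rw [← sub_eq_zero]
  -- Since `(K + c)(K - c) v = 0`, it suffices that `K + c` is injective. An eigenvalue `-c` of `K`
  -- would be a power of `q` with square `c ^ 2`; this forces equal exponents, hence `c = -c`.
  refine eq_zero_of_weight_scalar ρ hρ (K + c • 1)
    (fun w => qpow h ((D.d i : ℂ) * (w i : ℂ) / 2) + c) ?_ ?_ ?_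
  · intro w hw
    have hw' : qpow h ((D.d i : ℂ) * (w i : ℂ) / 2) = -c := by linear_combination hw
    have hsq : qpow h (((2 * (D.d i * w i) : ℤ) : ℂ) / 2)
        = qpow h (((2 * (D.d i * n) : ℤ) : ℂ) / 2) := by
      have e1 : (((2 * (D.d i * w i) : ℤ) : ℂ) / 2)
        = (D.d i : ℂ) * (w i : ℂ) / 2 + (D.d i : ℂ) * (w i : ℂ) / 2 := by push_cast; ring
      have e2 : (((2 * (D.d i * n) : ℤ) : ℂ) / 2) = (D.d i : ℂ) * (n : ℂ) := by push_cast; ring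
      rw [e1, e2, qpow_add, hw', hcc]; ring
    have hwn : (D.d i : ℤ) * w i = D.d i * n := by
      have := qpow_half_injective hq hsq; omega
    have hwn' : (D.d i : ℂ) * (w i : ℂ) = D.d i * n := by exact_mod_cast hwn
    rw [hwn'] at hw'
    have : c ≠ 0 := qpow_ne_zero _ _
    exact this (by linear_combination hw' / 2)
  · intro w v hv
    simp [K, (mem_weightSpace ρ w v).1 hv i, add_smul]
  · simp only [LinearMap.add_apply, LinearMap.smul_apply, Module.End.one_apply, map_sub, map_smul, hv]
    module

theorem commutes_of_commutes_gen {W : Type*} [AddCommGroup W] [Module ℂ W]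
    (ρ' : Uq D h →ₐ[ℂ] Module.End ℂ W) (f : V →ₗ[ℂ] W)
    (hf : ∀ g, f ∘ₗ ρ (gen D h g) = ρ' (gen D h g) ∘ₗ f) (ξ : Uq D h) :
    f ∘ₗ ρ ξ = ρ' ξ ∘ₗ f := by
  obtain ⟨x, rfl⟩ : ∃ x, mk D h x = ξ := RingQuot.mkAlgHom_surjective ℂ (Rel D h) ξ
  induction x using FreeAlgebra.induction with
  | grade0 r => ext v; simp [AlgHom.commutes]
  | grade1 g => exact hf g
  | mul a b ha hb =>
    rw [map_mul, map_mul, map_mul, Module.End.mul_eq_comp, Module.End.mul_eq_comp,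
      ← LinearMap.comp_assoc, ha, LinearMap.comp_assoc, hb, LinearMap.comp_assoc]
  | add a b ha hb =>
    rw [map_add, map_add, map_add, LinearMap.comp_add, LinearMap.add_comp, ha, hb]

end weights

/-! ### Weights of a nontrivial irreducible representation -/

/-- If `X_i^+` acts as zero, so does `[X_i^+, X_i^-]`, hence `k_i ^ 2 = k_i ^ (-2)`, which on a
vector of weight `a` says `q ^ (2 d_i a_i) = 1`. -/
theorem weight_eq_zero_of_X_eq_zero (V : QRep D h) (hq : ∀ r : ℕ, 0 < r → Complex.exp h ^ r ≠ 1) (i : ι)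
    (hX : V.ρ (gen D h (Gen.X 1 i)) = 0) {a : ι → ℤ} (ha : weightSpace V.ρ a ≠ ⊥) : a i = 0 := by
  obtain ⟨v, hv, hv0⟩ := Submodule.exists_mem_ne_zero_of_ne_bot ha
  have e := congrArg (fun x => V.ρ x v) (X_X_same D h i)
  have hd : (qpow h (D.d i) - qpow h (-(D.d i : ℂ)))⁻¹ ≠ 0 := by
    refine inv_ne_zero (sub_ne_zero.2 fun e => ?_)
    have := qpow_half_injective hq (m := 2 * D.d i) (n := -(2 * D.d i)) (by
      convert e using 2 <;> (push_cast; ring))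
    have := D.d_pos i
    omega
  simp only [map_sub, map_mul, hX, zero_mul, mul_zero, sub_self, LinearMap.zero_apply, map_smul,
    LinearMap.smul_apply, LinearMap.sub_apply, pow_two, Module.End.mul_apply,
    (mem_weightSpace V.ρ a v).1 hv i, kInv_weight V.ρ hv i, smul_smul, ← sub_smul, ← qpow_add] at e
  have e' := (smul_eq_zero.1 e.symm).resolve_right hv0
  have e'' := sub_eq_zero.1 ((mul_eq_zero.1 e').resolve_left hd)
  have := qpow_half_injective hq (m := 2 * (D.d i * a i)) (n := -(2 * (D.d i * a i))) (by
      convert e'' using 2 <;> (push_cast; ring))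
  have h0 : (D.d i : ℤ) * a i = 0 := by omega
  exact (mul_eq_zero.1 h0).resolve_left (by exact_mod_cast (D.d_pos i).ne')

theorem exists_weight_ne_bot (V : QRep D h) [Nontrivial V.carrier] :
    ∃ a, weightSpace V.ρ a ≠ ⊥ := by
  by_contra! hc
  have := V.weights
  simp [hc] at this

/-- The weights of a nontrivial irreducible representation differ by every simple root. -/
theorem exists_weight_add_root (V : QRep D h) (hq : ∀ r : ℕ, 0 < r → Complex.exp h ^ r ≠ 1)
    (hV : V.IsIrreducible) (hV' : 1 < Module.finrank ℂ V.carrier) (i : ι) :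
    ∃ a, weightSpace V.ρ a ≠ ⊥ ∧ weightSpace V.ρ (a + D.root i) ≠ ⊥ := by
  classical
  have := hV.1
  let P (i : ι) : Prop := ∃ a, weightSpace V.ρ a ≠ ⊥ ∧ weightSpace V.ρ (a + D.root i) ≠ ⊥
  -- A nonzero value of `X_i^±` on a weight vector would exhibit two weights differing by `α_i`.
  have hX : ∀ i, ¬ P i → ∀ s : ℤˣ, V.ρ (gen D h (Gen.X s i)) = 0 := by
    intro i hi s
    refine ext_weightSpace V.ρ V.weights fun c v hv => ?_
    rw [LinearMap.zero_apply]
    by_contra hne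
    have h1 : weightSpace V.ρ c ≠ ⊥ := (Submodule.ne_bot_iff _).2
      ⟨v, hv, fun e => hne (by rw [e, map_zero])⟩
    have h2 := (Submodule.ne_bot_iff _).2 ⟨_, X_weight V.ρ s i hv, hne⟩
    apply hi
    rcases Int.units_eq_one_or s with rfl | rfl
    · exact ⟨c, h1, by simpa using h2⟩
    · exact ⟨_, h2, by simpa using h1⟩
  by_contra hi
  let S : Finset ι := Finset.univ.filter P
  by_cases hS : S.Nonempty
  · have hS' : S ≠ Finset.univ := fun e =>
      hi (Finset.mem_filter.1 (e ▸ Finset.mem_univ i : i ∈ S)).2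
    -- Across an edge from `S` to its complement, `a` and `a + α_j` are both weights, and both
    -- vanish at `l` because `X_l^+ = 0`. This gives `A l j = 0`, contradicting `A j l ≠ 0`.
    obtain ⟨j, hj, l, hl, hjl⟩ := D.indecomposable S hS hS'
    obtain ⟨a, ha, ha'⟩ := (Finset.mem_filter.1 hj).2
    have hl' : ¬ P l := fun hP => hl (Finset.mem_filter.2 ⟨Finset.mem_univ _, hP⟩)
    have e1 := weight_eq_zero_of_X_eq_zero V hq l (hX l hl' 1) ha
    have e2 := weight_eq_zero_of_X_eq_zero V hq l (hX l hl' 1) ha'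
    have e3 : D.A l j = 0 := by simpa [e1, CartanDatum.root] using e2
    have e4 := d_mul_A_symm D j l
    rw [e3, Int.cast_zero, mul_zero] at e4
    have hdj : (D.d j : ℂ) ≠ 0 := by exact_mod_cast (D.d_pos j).ne'
    exact hjl (by exact_mod_cast (mul_eq_zero.1 e4).resolve_left hdj)
  -- Now all `X_j^±` act as zero, so a weight vector spans an invariant line and `V` would be
  -- one-dimensional.
  · have hP : ∀ j, ¬ P j := fun j hj => hS ⟨j, Finset.mem_filter.2 ⟨Finset.mem_univ _, hj⟩⟩
    obtain ⟨a, ha⟩ := exists_weight_ne_bot V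
    obtain ⟨v, hv, hv0⟩ := Submodule.exists_mem_ne_zero_of_ne_bot ha
    have hinv : ∀ ξ : Uq D h, ∃ c : ℂ, V.ρ ξ v = c • v := by
      intro ξ
      obtain ⟨x, rfl⟩ : ∃ x, mk D h x = ξ := RingQuot.mkAlgHom_surjective ℂ (Rel D h) ξ
      induction x using FreeAlgebra.induction with
      | grade0 r => exact ⟨r, by simp [AlgHom.commutes]⟩
      | grade1 g =>
        cases g with
        | k i => exact ⟨_, (mem_weightSpace V.ρ a v).1 hv i⟩
        | kInv i => exact ⟨_, kInv_weight V.ρ hv i⟩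
        | X s i => exact ⟨0, by rw [zero_smul]; exact congrArg (· v) (hX i (hP i) s)⟩
      | mul x y hx hy =>
        obtain ⟨c, hc⟩ := hx
        obtain ⟨c', hc'⟩ := hy
        exact ⟨c' * c, by rw [map_mul, map_mul, Module.End.mul_apply, hc', map_smul, hc, smul_smul]⟩
      | add x y hx hy =>
        obtain ⟨c, hc⟩ := hx
        obtain ⟨c', hc'⟩ := hy
        exact ⟨c + c', by rw [map_add, map_add, LinearMap.add_apply, hc, hc', add_smul]⟩
    have hspan := hV.2 (ℂ ∙ v) fun ξ w hw => by
      obtain ⟨r, rfl⟩ := Submodule.mem_span_singleton.1 hw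
      obtain ⟨c, hc⟩ := hinv ξ
      rw [map_smul, hc]
      exact Submodule.smul_mem _ _ (Submodule.smul_mem _ _ (Submodule.mem_span_singleton_self v))
    rcases hspan with e | e
    · exact hv0 (Submodule.span_singleton_eq_bot.1 e)
    · have := finrank_span_singleton (K := ℂ) hv0
      rw [e, finrank_top] at this
      omega

/-! ### Contractions and the leading term of the `R`-matrix -/

section contraction

variable {V V' W W' : Type*} [AddCommGroup V] [Module ℂ V] [AddCommGroup V'] [Module ℂ V']
  [AddCommGroup W] [Module ℂ W] [AddCommGroup W'] [Module ℂ W']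

/-- The contraction `v ⊗ w ↦ φ v • w`. -/
def contractLeft (W : Type*) [AddCommGroup W] [Module ℂ W] (φ : V →ₗ[ℂ] ℂ) : V ⊗[ℂ] W →ₗ[ℂ] W :=
  (TensorProduct.lid ℂ W).toLinearMap ∘ₗ φ.rTensor W

/-- The contraction `w ⊗ v ↦ φ v • w`. -/
def contractRight (W : Type*) [AddCommGroup W] [Module ℂ W] (φ : V →ₗ[ℂ] ℂ) : W ⊗[ℂ] V →ₗ[ℂ] W :=
  (TensorProduct.rid ℂ W).toLinearMap ∘ₗ φ.lTensor W

@[simp]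
theorem contractLeft_tmul (φ : V →ₗ[ℂ] ℂ) (v : V) (w : W) :
    contractLeft W φ (v ⊗ₜ w) = φ v • w := by
  simp [contractLeft]

@[simp]
theorem contractRight_tmul (φ : V →ₗ[ℂ] ℂ) (v : V) (w : W) :
    contractRight W φ (w ⊗ₜ v) = φ v • w := by
  simp [contractRight]

theorem contractLeft_map (φ : V' →ₗ[ℂ] ℂ) (g : V →ₗ[ℂ] V') (f : W →ₗ[ℂ] W') (t : V ⊗[ℂ] W) :
    contractLeft W' φ (TensorProduct.map g f t) = f (contractLeft W (φ ∘ₗ g) t) := by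
  induction t with
  | zero => simp
  | tmul v w => simp
  | add x y hx hy => simp only [map_add, hx, hy]

theorem contractRight_map (φ : V' →ₗ[ℂ] ℂ) (g : V →ₗ[ℂ] V') (f : W →ₗ[ℂ] W') (t : W ⊗[ℂ] V) :
    contractRight W' φ (TensorProduct.map f g t) = f (contractRight W (φ ∘ₗ g) t) := by
  induction t with
  | zero => simp
  | tmul v w => simp
  | add x y hx hy => simp only [map_add, hx, hy]

theorem map_sub_right_apply (g : V →ₗ[ℂ] V') (f f' : W →ₗ[ℂ] W') (t : V ⊗[ℂ] W) :
    TensorProduct.map g (f - f') t = TensorProduct.map g f t - TensorProduct.map g f' t := by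
  induction t with
  | zero => simp
  | tmul v w => simp [TensorProduct.tmul_sub]
  | add x y hx hy => rw [map_add, map_add, map_add, hx, hy]; abel

theorem map_sub_left_apply (g g' : V →ₗ[ℂ] V') (f : W →ₗ[ℂ] W') (t : V ⊗[ℂ] W) :
    TensorProduct.map (g - g') f t = TensorProduct.map g f t - TensorProduct.map g' f t := by
  induction t with
  | zero => simp
  | tmul v w => simp [TensorProduct.sub_tmul]
  | add x y hx hy => rw [map_add, map_add, map_add, hx, hy]; abel

end contraction

/-- Simple roots are linearly independent, so every correction term of `R` really changes the
weights of both factors. -/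
theorem CartanDatum.mulVec_cast_ne_zero (D : CartanDatum ι) {β : ι → ℕ} (hβ : β ≠ 0) :
    (D.A.mulVec fun j => (β j : ℤ)) ≠ 0 := by
  intro e
  apply hβ
  ext j
  simpa using congrFun (D.mulVec_injective e) j

/-- The correction terms have first factor of weight `a - β ≠ a`, where `φ` vanishes; only the
leading term survives. -/
theorem contractLeft_R (𝓡 : UniversalRMatrix D h) (V W : QRep D h) {a b : ι → ℤ} {v : V.carrier}
    {w : W.carrier} (hv : v ∈ weightSpace V.ρ a) (hw : w ∈ weightSpace W.ρ b)
    (φ : V.carrier →ₗ[ℂ] ℂ) (hφ : ∀ c ≠ a, ∀ u ∈ weightSpace V.ρ c, φ u = 0) :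
    contractLeft W.carrier φ (𝓡.R V W (v ⊗ₜ w)) = (qpow h (weightForm D a b) * φ v) • w := by
  have hl := 𝓡.leading V W a b v hv w hw
  have hker : (⨆ β : {β : ι → ℕ // β ≠ 0},
        tensorSub (weightSpace V.ρ (a - D.A.mulVec fun j => (β.1 j : ℤ)))
          (weightSpace W.ρ (b + D.A.mulVec fun j => (β.1 j : ℤ))))
      ≤ LinearMap.ker (contractLeft W.carrier φ) := by
    refine iSup_le fun β => Submodule.map₂_le.2 fun x hx y hy => ?_
    rw [LinearMap.mem_ker, TensorProduct.mk_apply, contractLeft_tmul, hφ _ ?_ x hx, zero_smul]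
    exact fun e => D.mulVec_cast_ne_zero β.2 (by simpa using e)
  have := hker hl
  rw [LinearMap.mem_ker, map_sub, sub_eq_zero] at this
  rw [this, map_smul, contractLeft_tmul, smul_smul]

theorem contractRight_R (𝓡 : UniversalRMatrix D h) (V W : QRep D h) {a b : ι → ℤ} {v : V.carrier}
    {w : W.carrier} (hv : v ∈ weightSpace V.ρ a) (hw : w ∈ weightSpace W.ρ b)
    (φ : W.carrier →ₗ[ℂ] ℂ) (hφ : ∀ c ≠ b, ∀ u ∈ weightSpace W.ρ c, φ u = 0) :
    contractRight V.carrier φ (𝓡.R V W (v ⊗ₜ w)) = (qpow h (weightForm D a b) * φ w) • v := by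
  have hl := 𝓡.leading V W a b v hv w hw
  have hker : (⨆ β : {β : ι → ℕ // β ≠ 0},
        tensorSub (weightSpace V.ρ (a - D.A.mulVec fun j => (β.1 j : ℤ)))
          (weightSpace W.ρ (b + D.A.mulVec fun j => (β.1 j : ℤ))))
      ≤ LinearMap.ker (contractRight V.carrier φ) := by
    refine iSup_le fun β => Submodule.map₂_le.2 fun x hx y hy => ?_
    rw [LinearMap.mem_ker, TensorProduct.mk_apply, contractRight_tmul, hφ _ ?_ y hy, zero_smul]
    exact fun e => D.mulVec_cast_ne_zero β.2 (by simpa using e)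
  have := hker hl
  rw [LinearMap.mem_ker, map_sub, sub_eq_zero] at this
  rw [this, map_smul, contractRight_tmul, smul_smul]

/-! ### Maps that commute with the `L`-operators are intertwiners -/

theorem act₂_comul_X (V W : QRep D h) (s : ℤˣ) (i : ι) :
    V.act₂ W (comul D h (gen D h (Gen.X s i)))
      = TensorProduct.map (V.ρ (gen D h (Gen.X s i))) (W.ρ (gen D h (Gen.kInv i)))
        + TensorProduct.map (V.ρ (gen D h (Gen.k i))) (W.ρ (gen D h (Gen.X s i))) := by
  rw [comul_gen, comulGen, map_add]
  refine congrArg₂ _ ?_ ?_ <;> exact TensorProduct.ext' fun v w => act₂_tmul V W _ _ v w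

theorem act₂_comulOp_X (V W : QRep D h) (s : ℤˣ) (i : ι) :
    V.act₂ W (comulOp D h (gen D h (Gen.X s i)))
      = TensorProduct.map (V.ρ (gen D h (Gen.kInv i))) (W.ρ (gen D h (Gen.X s i)))
        + TensorProduct.map (V.ρ (gen D h (Gen.X s i))) (W.ρ (gen D h (Gen.k i))) := by
  have e : comulOp D h (gen D h (Gen.X s i))
      = gen D h (Gen.kInv i) ⊗ₜ gen D h (Gen.X s i)
        + gen D h (Gen.X s i) ⊗ₜ gen D h (Gen.k i) := by
    change Algebra.TensorProduct.comm ℂ (Uq D h) (Uq D h) (comul D h (gen D h (Gen.X s i))) = _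
    rw [comul_gen, comulGen, map_add, Algebra.TensorProduct.comm_tmul,
      Algebra.TensorProduct.comm_tmul]
  rw [e, map_add]
  refine congrArg₂ _ ?_ ?_ <;> exact TensorProduct.ext' fun v w => act₂_tmul V W _ _ v w

section commutes

variable (𝓡 : UniversalRMatrix D h) {V W W' : QRep D h} {f : W.carrier →ₗ[ℂ] W'.carrier}

/-- The diagonal block `Q` of `R(V, ·)` at a weight `a` of `V` acts by `q ^ (a, c)` on weight `c`
and is compatible with `f`. Comparing the blocks at `a` and `a + α_i` shows how `k_i ^ 2` acts on `f
w`, and this determines the action of `k_i`. -/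
theorem map_weightSpace_of_commutes (hq : ∀ r : ℕ, 0 < r → Complex.exp h ^ r ≠ 1)
    (hV : V.IsIrreducible) (hV' : 1 < Module.finrank ℂ V.carrier)
    (hR : ∀ t, 𝓡.R V W' (f.lTensor V.carrier t) = f.lTensor V.carrier (𝓡.R V W t))
    {b : ι → ℤ} {w : W.carrier} (hw : w ∈ weightSpace W.ρ b) : f w ∈ weightSpace W'.ρ b := by
  have key : ∀ a, weightSpace V.ρ a ≠ ⊥ → ∃ Q : Module.End ℂ W'.carrier,
      (∀ c, ∀ u ∈ weightSpace W'.ρ c, Q u = qpow h (weightForm D a c) • u) ∧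
        Q (f w) = qpow h (weightForm D a b) • f w := by
    intro a ha
    obtain ⟨v, hv, hv0⟩ := Submodule.exists_mem_ne_zero_of_ne_bot ha
    obtain ⟨φ, hφ1, hφ⟩ := exists_weight_functional V.ρ hq hv hv0
    refine ⟨contractLeft W'.carrier φ ∘ₗ (𝓡.R V W').toLinearMap ∘ₗ
      TensorProduct.mk ℂ V.carrier W'.carrier v, fun c u hu => ?_, ?_⟩
    · have := contractLeft_R 𝓡 V W' hv hu φ hφ
      rw [hφ1, mul_one] at this
      exact this
    · have e := hR (v ⊗ₜ w)
      rw [LinearMap.lTensor_tmul] at e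
      change contractLeft W'.carrier φ (𝓡.R V W' (v ⊗ₜ f w)) = _
      rw [e]
      change contractLeft W'.carrier φ (TensorProduct.map LinearMap.id f _) = _
      rw [contractLeft_map, LinearMap.comp_id, contractLeft_R 𝓡 V W hv hw φ hφ, hφ1, mul_one,
        map_smul]
  rw [mem_weightSpace]
  intro i
  obtain ⟨a, ha, ha'⟩ := exists_weight_add_root V hq hV hV' i
  obtain ⟨Q, hQ, hQf⟩ := key _ ha
  obtain ⟨Q', hQ', hQf'⟩ := key _ ha'
  refine k_eq_of_sq_eq W'.ρ hq W'.weights i (b i) ?_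
  -- The exponents differ by `(α_i, c) = d_i c_i`, which is the exponent of `k_i ^ 2` on weight `c`.
  have hQQ : Q' = W'.ρ (gen D h (Gen.k i)) ∘ₗ W'.ρ (gen D h (Gen.k i)) ∘ₗ Q := by
    refine ext_weightSpace W'.ρ W'.weights fun c u hu => ?_
    have hk := (mem_weightSpace W'.ρ c u).1 hu i
    simp only [LinearMap.comp_apply, hQ c u hu, hQ' c u hu, map_smul, hk, smul_smul, ← qpow_add]
    rw [weightForm_add_left, weightForm_root_left]
    congr 2; ring
  rw [hQQ, LinearMap.comp_apply, LinearMap.comp_apply, hQf, map_smul, map_smul, weightForm_add_left,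
    weightForm_root_left, qpow_add, mul_smul] at hQf'
  exact smul_right_injective _ (qpow_ne_zero h (weightForm D a b)) hQf'

/-- Two weights differing by `α_i` have values at `i` differing by `A i i = 2`, so they cannot both
vanish there. -/
theorem exists_weight_apply_ne_zero (hq : ∀ r : ℕ, 0 < r → Complex.exp h ^ r ≠ 1)
    (hV : V.IsIrreducible) (hV' : 1 < Module.finrank ℂ V.carrier) (i : ι) :
    ∃ a, weightSpace V.ρ a ≠ ⊥ ∧ a i ≠ 0 := by
  obtain ⟨a, ha, ha'⟩ := exists_weight_add_root V hq hV hV' i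
  by_cases hai : a i = 0
  · exact ⟨_, ha', by simp [hai, CartanDatum.root, D.diag]⟩
  · exact ⟨a, ha, hai⟩

/-- The defect `δ` raises weights by `α_i`, and quasi-cocommutativity makes it intertwine `R` up to
`k_i` on the other factor. The resulting powers of `q` disagree on leading terms unless `δ` is zero.
-/
theorem X_one_comp_of_commutes (hq : ∀ r : ℕ, 0 < r → Complex.exp h ^ r ≠ 1)
    (hV : V.IsIrreducible) (hV' : 1 < Module.finrank ℂ V.carrier)
    (hR : ∀ t, 𝓡.R V W' (f.lTensor V.carrier t) = f.lTensor V.carrier (𝓡.R V W t))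
    (hf : ∀ b, ∀ w ∈ weightSpace W.ρ b, f w ∈ weightSpace W'.ρ b)
    (hk : f ∘ₗ W.ρ (gen D h (Gen.k i)) = W'.ρ (gen D h (Gen.k i)) ∘ₗ f)
    (hkInv : f ∘ₗ W.ρ (gen D h (Gen.kInv i)) = W'.ρ (gen D h (Gen.kInv i)) ∘ₗ f) :
    f ∘ₗ W.ρ (gen D h (Gen.X 1 i)) = W'.ρ (gen D h (Gen.X 1 i)) ∘ₗ f := by
  set δ := W'.ρ (gen D h (Gen.X 1 i)) ∘ₗ f - f ∘ₗ W.ρ (gen D h (Gen.X 1 i)) with hδ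
  -- In the difference of the relations for `W'` and `W`, the terms with `X_i` on `V` cancel, since
  -- `f` commutes with `k_i` and `k_i⁻¹`.
  have hδR : ∀ t, 𝓡.R V W' (TensorProduct.map (V.ρ (gen D h (Gen.k i))) δ t)
      = TensorProduct.map (V.ρ (gen D h (Gen.kInv i))) δ (𝓡.R V W t) := by
    intro t
    have e1 := LinearMap.congr_fun (𝓡.quasiCocomm V W (gen D h (Gen.X 1 i))) t
    have e2 := LinearMap.congr_fun (𝓡.quasiCocomm V W' (gen D h (Gen.X 1 i)))
      (f.lTensor V.carrier t)
    rw [act₂_comul_X, act₂_comulOp_X] at e1 e2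
    have e1' := congrArg (f.lTensor V.carrier) e1
    simp only [LinearMap.comp_apply, LinearMap.add_apply, LinearEquiv.coe_coe, map_add, hR] at e1' e2
    simp only [← hR] at e1'
    simp only [← LinearMap.comp_apply, LinearMap.lTensor_comp_map, LinearMap.map_comp_lTensor]
      at e1' e2
    rw [hk, hkInv] at e1'
    rw [hδ, map_sub_right_apply, map_sub_right_apply, map_sub]
    simpa only [add_sub_add_left_eq_sub, add_sub_add_right_eq_sub] using
      congrArg₂ (· - ·) e2 e1'
  rw [eq_comm, ← sub_eq_zero, ← hδ]
  obtain ⟨a, ha, hai⟩ := exists_weight_apply_ne_zero hq hV hV' i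
  obtain ⟨v, hv, hv0⟩ := Submodule.exists_mem_ne_zero_of_ne_bot ha
  obtain ⟨φ, hφ1, hφ⟩ := exists_weight_functional V.ρ hq hv hv0
  refine ext_weightSpace W.ρ W.weights fun b w hw => ?_
  have hδw : δ w ∈ weightSpace W'.ρ (b + D.root i) := by
    have h1 := X_weight W'.ρ 1 i (hf b w hw)
    have h2 := hf _ _ (X_weight W.ρ 1 i hw)
    rw [Units.val_one, one_smul] at h1 h2
    exact Submodule.sub_mem _ h1 h2
  have e := congrArg (contractLeft W'.carrier φ) (hδR (v ⊗ₜ w))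
  rw [contractLeft_map, contractLeft_R 𝓡 V W hv hw _ ?_, TensorProduct.map_tmul,
    (mem_weightSpace V.ρ a v).1 hv i, ← TensorProduct.smul_tmul', map_smul, map_smul,
    contractLeft_R 𝓡 V W' hv hδw φ hφ, LinearMap.comp_apply, kInv_weight V.ρ hv, map_smul, hφ1,
    map_smul, smul_smul, ← sub_eq_zero, ← sub_smul, weightForm_add_right, weightForm_root_right] at e
  · refine (smul_eq_zero.1 e).resolve_left fun e0 => hai ?_
    rw [smul_eq_mul, hφ1, mul_one, mul_one, ← qpow_add, ← qpow_add, sub_eq_zero] at e0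
    -- Beyond the common `(a, b)`, the exponents are `3 d_i a_i / 2` on the left and `-d_i a_i / 2`
    -- on the right. Their difference `2 d_i a_i` is written as half of `4 d_i a_i`.
    have h0 : 4 * (D.d i : ℤ) * a i = 0 := eq_zero_of_qpow_eq hq e0 (by push_cast; ring)
    exact (mul_eq_zero.1 h0).resolve_left (by have := D.d_pos i; omega)
  · intro c hc u hu
    rw [LinearMap.comp_apply, kInv_weight V.ρ hu, map_smul, hφ c hc u hu, smul_zero]

/-- Here `V` must stand on the right. With `V` on the left, a defect that lowers weights by `α_i`
gives the same power of `q` on both sides of the leading-term comparison, and nothing follows. -/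
theorem X_neg_one_comp_of_commutes (hq : ∀ r : ℕ, 0 < r → Complex.exp h ^ r ≠ 1)
    (hV : V.IsIrreducible) (hV' : 1 < Module.finrank ℂ V.carrier)
    (hR : ∀ t, 𝓡.R W' V (f.rTensor V.carrier t) = f.rTensor V.carrier (𝓡.R W V t))
    (hf : ∀ b, ∀ w ∈ weightSpace W.ρ b, f w ∈ weightSpace W'.ρ b)
    (hk : f ∘ₗ W.ρ (gen D h (Gen.k i)) = W'.ρ (gen D h (Gen.k i)) ∘ₗ f)
    (hkInv : f ∘ₗ W.ρ (gen D h (Gen.kInv i)) = W'.ρ (gen D h (Gen.kInv i)) ∘ₗ f) :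
    f ∘ₗ W.ρ (gen D h (Gen.X (-1) i)) = W'.ρ (gen D h (Gen.X (-1) i)) ∘ₗ f := by
  set δ := W'.ρ (gen D h (Gen.X (-1) i)) ∘ₗ f - f ∘ₗ W.ρ (gen D h (Gen.X (-1) i)) with hδ
  have hδR : ∀ t, 𝓡.R W' V (TensorProduct.map δ (V.ρ (gen D h (Gen.kInv i))) t)
      = TensorProduct.map δ (V.ρ (gen D h (Gen.k i))) (𝓡.R W V t) := by
    intro t
    have e1 := LinearMap.congr_fun (𝓡.quasiCocomm W V (gen D h (Gen.X (-1) i))) t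
    have e2 := LinearMap.congr_fun (𝓡.quasiCocomm W' V (gen D h (Gen.X (-1) i)))
      (f.rTensor V.carrier t)
    rw [act₂_comul_X, act₂_comulOp_X] at e1 e2
    have e1' := congrArg (f.rTensor V.carrier) e1
    simp only [LinearMap.comp_apply, LinearMap.add_apply, LinearEquiv.coe_coe, map_add, hR] at e1' e2
    simp only [← hR] at e1'
    simp only [← LinearMap.comp_apply, LinearMap.rTensor_comp_map, LinearMap.map_comp_rTensor]
      at e1' e2
    rw [hk, hkInv] at e1'
    rw [hδ, map_sub_left_apply, map_sub_left_apply, map_sub]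
    simpa only [add_sub_add_left_eq_sub, add_sub_add_right_eq_sub] using
      congrArg₂ (· - ·) e2 e1'
  rw [eq_comm, ← sub_eq_zero, ← hδ]
  obtain ⟨a, ha, hai⟩ := exists_weight_apply_ne_zero hq hV hV' i
  obtain ⟨v, hv, hv0⟩ := Submodule.exists_mem_ne_zero_of_ne_bot ha
  obtain ⟨φ, hφ1, hφ⟩ := exists_weight_functional V.ρ hq hv hv0
  refine ext_weightSpace W.ρ W.weights fun b w hw => ?_
  have hδw : δ w ∈ weightSpace W'.ρ (b - D.root i) := by
    have h1 := X_weight W'.ρ (-1) i (hf b w hw)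
    have h2 := hf _ _ (X_weight W.ρ (-1) i hw)
    rw [Units.val_neg, Units.val_one, neg_smul, one_smul, ← sub_eq_add_neg] at h1 h2
    exact Submodule.sub_mem _ h1 h2
  have hform : weightForm D b a = weightForm D (b - D.root i) a + (D.d i : ℂ) * (a i : ℂ) := by
    rw [← weightForm_root_left, ← weightForm_add_left, sub_add_cancel]
  have e := congrArg (contractRight W'.carrier φ) (hδR (w ⊗ₜ v))
  rw [contractRight_map, contractRight_R 𝓡 W V hw hv _ ?_, TensorProduct.map_tmul,
    kInv_weight V.ρ hv, TensorProduct.tmul_smul, map_smul, map_smul,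
    contractRight_R 𝓡 W' V hδw hv φ hφ, LinearMap.comp_apply, (mem_weightSpace V.ρ a v).1 hv i,
    map_smul, hφ1, map_smul, smul_smul, ← sub_eq_zero, ← sub_smul, hform] at e
  · refine (smul_eq_zero.1 e).resolve_left fun e0 => hai ?_
    rw [smul_eq_mul, hφ1, mul_one, mul_one, ← qpow_add, ← qpow_add, sub_eq_zero] at e0
    have h0 : 4 * (D.d i : ℤ) * a i = 0 := eq_zero_of_qpow_eq hq e0.symm (by push_cast; ring)
    exact (mul_eq_zero.1 h0).resolve_left (by have := D.d_pos i; omega)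
  · intro c hc u hu
    rw [LinearMap.comp_apply, (mem_weightSpace V.ρ c u).1 hu i, map_smul, hφ c hc u hu, smul_zero]

/-- A linear map that commutes with the operators `R(V, ·)` and `R(·, V)` for one nontrivial
irreducible representation `V` is an intertwiner. -/
theorem isIntertwiner_of_commutes (hq : ∀ r : ℕ, 0 < r → Complex.exp h ^ r ≠ 1)
    (hV : V.IsIrreducible) (hV' : 1 < Module.finrank ℂ V.carrier)
    (hR : ∀ t, 𝓡.R V W' (f.lTensor V.carrier t) = f.lTensor V.carrier (𝓡.R V W t))
    (hR' : ∀ t, 𝓡.R W' V (f.rTensor V.carrier t) = f.rTensor V.carrier (𝓡.R W V t)) :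
    IsIntertwiner W W' f := by
  have hf : ∀ b, ∀ w ∈ weightSpace W.ρ b, f w ∈ weightSpace W'.ρ b := fun b w hw =>
    map_weightSpace_of_commutes 𝓡 hq hV hV' hR hw
  have hk : ∀ i, f ∘ₗ W.ρ (gen D h (Gen.k i)) = W'.ρ (gen D h (Gen.k i)) ∘ₗ f := fun i =>
    ext_weightSpace W.ρ W.weights fun b w hw => by
      rw [LinearMap.comp_apply, LinearMap.comp_apply, (mem_weightSpace W.ρ b w).1 hw i,
        (mem_weightSpace W'.ρ b _).1 (hf b w hw) i, map_smul]
  have hkInv : ∀ i, f ∘ₗ W.ρ (gen D h (Gen.kInv i)) = W'.ρ (gen D h (Gen.kInv i)) ∘ₗ f := fun i =>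
    ext_weightSpace W.ρ W.weights fun b w hw => by
      rw [LinearMap.comp_apply, LinearMap.comp_apply, kInv_weight W.ρ hw i,
        kInv_weight W'.ρ (hf b w hw) i, map_smul]
  refine commutes_of_commutes_gen W.ρ W'.ρ f fun g => ?_
  cases g with
  | k i => exact hk i
  | kInv i => exact hkInv i
  | X s i =>
    rcases Int.units_eq_one_or s with rfl | rfl
    · exact X_one_comp_of_commutes 𝓡 hq hV hV' hR hf (hk i) (hkInv i)
    · exact X_neg_one_comp_of_commutes 𝓡 hq hV hV' hR' hf (hk i) (hkInv i)

end commutes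

/-! ### Schur's lemma -/

theorem QRep.IsIntertwiner.eq_zero_or_equivalent {V W : QRep D h} (hV : V.IsIrreducible)
    (hW : W.IsIrreducible) {f : V.carrier →ₗ[ℂ] W.carrier} (hf : IsIntertwiner V W f) :
    f = 0 ∨ Equivalent V W := by
  rcases hV.2 (LinearMap.ker f) fun ξ v hv => by
    have := LinearMap.congr_fun (hf ξ) v
    simp only [LinearMap.comp_apply] at this
    rw [LinearMap.mem_ker, this, hv, map_zero] with hk | hk
  · rcases hW.2 (LinearMap.range f) fun ξ w hw => by
      obtain ⟨v, rfl⟩ := hw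
      exact ⟨V.ρ ξ v, LinearMap.congr_fun (hf ξ) v⟩ with hr | hr
    · exact Or.inl (LinearMap.range_eq_bot.1 hr)
    · exact Or.inr ⟨LinearEquiv.ofBijective f ⟨LinearMap.ker_eq_bot.1 hk,
        LinearMap.range_eq_top.1 hr⟩, hf⟩
  · exact Or.inl (LinearMap.ker_eq_top.1 hk)

theorem QRep.IsIntertwiner.exists_eq_smul_id {V : QRep D h} (hV : V.IsIrreducible)
    {f : V.carrier →ₗ[ℂ] V.carrier} (hf : IsIntertwiner V V f) :
    ∃ c : ℂ, f = c • LinearMap.id := by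
  have := hV.1
  obtain ⟨c, hc⟩ := Module.End.exists_eigenvalue f
  refine ⟨c, ?_⟩
  rcases hV.2 (Module.End.eigenspace f c) fun ξ v hv => by
    rw [Module.End.mem_eigenspace_iff] at hv ⊢
    have := LinearMap.congr_fun (hf ξ) v
    simp only [LinearMap.comp_apply] at this
    rw [this, hv, map_smul] with hk | hk
  · exact absurd hk hc
  · ext v
    exact Module.End.mem_eigenspace_iff.1 (hk ▸ Submodule.mem_top : v ∈ Module.End.eigenspace f c)

/-- An intertwiner from a tensor product to an irreducible representation is a linear combination
of Clebsch-Gordan maps. -/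
theorem ClebschGordan.exists_eq_sum {Λ : Type*} {irr : Λ → QRep D h}
    (hirr : IsIrrepList irr) {I J : QRep D h} (cg : ClebschGordan irr I J) {K : Λ}
    {f : I.carrier ⊗[ℂ] J.carrier →ₗ[ℂ] (irr K).carrier}
    (hf : IsIntertwiner (I.tensor J) (irr K) f) :
    ∃ c : Fin (cg.mult K) → ℂ, f = ∑ a, c a • cg.C K a := by
  classical
  have hint : ∀ L a, IsIntertwiner (irr L) (irr K) (f ∘ₗ cg.C' L a) := by
    intro L a ξ
    rw [LinearMap.comp_assoc, ← cg.intertwines' L a ξ, ← LinearMap.comp_assoc,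
      ← LinearMap.comp_assoc]
    exact congrArg (· ∘ₗ cg.C' L a) (hf ξ)
  choose c hc using fun a => (hint K a).exists_eq_smul_id (hirr.irreducible K)
  refine ⟨c, ?_⟩
  have hz : ∀ L a, L ≠ K → f ∘ₗ cg.C' L a = 0 := fun L a hL =>
    ((hint L a).eq_zero_or_equivalent (hirr.irreducible L) (hirr.irreducible K)).resolve_right
      fun e => hL (hirr.inequivalent L K e)
  -- Completeness is inserted after `f`. By Schur's lemma each `f ∘ₗ cg.C' L a` is a scalar for `L =
  -- K` and zero otherwise.
  have e : f = ∑ L ∈ cg.support, ∑ a, (f ∘ₗ cg.C' L a) ∘ₗ cg.C L a := by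
    conv_lhs => rw [← LinearMap.comp_id f, ← cg.complete]
    ext t
    simp
  by_cases hK : K ∈ cg.support
  · rw [Finset.sum_eq_single_of_mem K hK fun L _ hL => Finset.sum_eq_zero fun a _ => by
      rw [hz L a hL, LinearMap.zero_comp]] at e
    rw [e]
    refine Finset.sum_congr rfl fun a _ => ?_
    rw [hc, LinearMap.smul_comp, LinearMap.id_comp]
  · have h0 : cg.mult K = 0 := not_not.1 fun h0 => hK ((cg.mem_support K).2 h0)
    have : IsEmpty (Fin (cg.mult K)) := by rw [h0]; infer_instance
    rw [Finset.univ_eq_empty, Finset.sum_empty, e]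
    refine Finset.sum_eq_zero fun L hL => Finset.sum_eq_zero fun a _ => ?_
    rw [hz L a fun h => hK (h ▸ hL), LinearMap.zero_comp]

/-! ### Operators on triple tensor products -/

section triple

variable {V₀ I J V M N : Type*} [AddCommGroup V₀] [Module ℂ V₀] [AddCommGroup I] [Module ℂ I]
  [AddCommGroup J] [Module ℂ J] [AddCommGroup V] [Module ℂ V] [AddCommGroup M] [Module ℂ M]
  [AddCommGroup N] [Module ℂ N]

theorem conj_comp_apply {X Y : Type*} [AddCommGroup X] [Module ℂ X] [AddCommGroup Y] [Module ℂ Y]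
    (e : X ≃ₗ[ℂ] Y) (g : Module.End ℂ X) (y : Y) : e.conj g y = e (g (e.symm y)) := rfl

/-- The flip in the last two factors interchanges `op12` and `op13`. -/
theorem lTensor_comm_op13 (g : Module.End ℂ (V₀ ⊗[ℂ] I)) (t : V₀ ⊗[ℂ] (J ⊗[ℂ] I)) :
    (TensorProduct.comm ℂ J I).toLinearMap.lTensor V₀ (op13 J g t)
      = op12 J g ((TensorProduct.comm ℂ J I).toLinearMap.lTensor V₀ t) := by
  induction t with
  | zero => simp
  | add x y hx hy => simp only [map_add, hx, hy]
  | tmul x t =>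
    induction t with
    | zero => simp
    | add y z hy hz => simp only [map_add, TensorProduct.tmul_add, hy, hz]
    | tmul j i =>
      simp only [op13, op12, conj_comp_apply, LinearMap.lTensor_tmul, LinearEquiv.coe_coe,
        TensorProduct.comm_tmul, TensorProduct.assoc_symm_tmul, TensorProduct.leftComm_symm_tmul,
        LinearMap.rTensor_tmul]
      generalize g (x ⊗ₜ i) = u
      induction u with
      | zero => simp
      | add y z hy hz => simp only [map_add, TensorProduct.tmul_add, TensorProduct.add_tmul, hy, hz]
      | tmul y z => simp

theorem lTensor_comm_op12 (g : Module.End ℂ (V₀ ⊗[ℂ] J)) (t : V₀ ⊗[ℂ] (J ⊗[ℂ] I)) :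
    (TensorProduct.comm ℂ J I).toLinearMap.lTensor V₀ (op12 I g t)
      = op13 I g ((TensorProduct.comm ℂ J I).toLinearMap.lTensor V₀ t) := by
  induction t with
  | zero => simp
  | add x y hx hy => simp only [map_add, hx, hy]
  | tmul x t =>
    induction t with
    | zero => simp
    | add y z hy hz => simp only [map_add, TensorProduct.tmul_add, hy, hz]
    | tmul j i =>
      simp only [op13, op12, conj_comp_apply, LinearMap.lTensor_tmul, LinearEquiv.coe_coe,
        TensorProduct.comm_tmul, TensorProduct.assoc_symm_tmul, TensorProduct.leftComm_symm_tmul,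
        LinearMap.rTensor_tmul]
      generalize g (x ⊗ₜ j) = u
      induction u with
      | zero => simp
      | add y z hy hz => simp only [map_add, TensorProduct.tmul_add, TensorProduct.add_tmul, hy, hz]
      | tmul y z => simp

/-- Moving `V₀` from the last place to the first. -/
def rotate (I J V₀ : Type*) [AddCommGroup V₀] [Module ℂ V₀] [AddCommGroup I] [Module ℂ I]
    [AddCommGroup J] [Module ℂ J] : I ⊗[ℂ] (J ⊗[ℂ] V₀) ≃ₗ[ℂ] V₀ ⊗[ℂ] (I ⊗[ℂ] J) :=
  (TensorProduct.assoc ℂ I J V₀).symm.trans (TensorProduct.comm ℂ (I ⊗[ℂ] J) V₀)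

@[simp]
theorem rotate_tmul (x : I) (y : J) (z : V₀) : rotate I J V₀ (x ⊗ₜ (y ⊗ₜ z)) = z ⊗ₜ (x ⊗ₜ y) := by
  simp [rotate]

/-- With `V₀` moved to the front, the positions `1, 3` become `1, 2`, and in `rotate_op23` the
positions `2, 3` become `1, 3`. This carries `(Δ ⊗ id) R` to the ordering used for `R_-`. -/
theorem rotate_op13 (g : Module.End ℂ (I ⊗[ℂ] V₀)) (t : I ⊗[ℂ] (J ⊗[ℂ] V₀)) :
    rotate I J V₀ (op13 J g t)
      = op12 J ((TensorProduct.comm ℂ I V₀).conj g) (rotate I J V₀ t) := by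
  induction t with
  | zero => simp
  | add x y hx hy => simp only [map_add, hx, hy]
  | tmul i t =>
    induction t with
    | zero => simp
    | add y z hy hz => simp only [map_add, TensorProduct.tmul_add, hy, hz]
    | tmul j x =>
      simp only [op13, op12, conj_comp_apply, rotate_tmul, LinearMap.lTensor_tmul,
        TensorProduct.comm_symm_tmul, TensorProduct.assoc_symm_tmul,
        TensorProduct.leftComm_symm_tmul, LinearMap.rTensor_tmul]
      generalize g (i ⊗ₜ x) = u
      induction u with
      | zero => simp
      | add y z hy hz => simp only [map_add, TensorProduct.tmul_add, TensorProduct.add_tmul, hy, hz]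
      | tmul y z => simp

theorem rotate_op23 (g : Module.End ℂ (J ⊗[ℂ] V₀)) (t : I ⊗[ℂ] (J ⊗[ℂ] V₀)) :
    rotate I J V₀ (op23 I g t)
      = op13 I ((TensorProduct.comm ℂ J V₀).conj g) (rotate I J V₀ t) := by
  induction t with
  | zero => simp
  | add x y hx hy => simp only [map_add, hx, hy]
  | tmul i t =>
    induction t with
    | zero => simp
    | add y z hy hz => simp only [map_add, TensorProduct.tmul_add, hy, hz]
    | tmul j x =>
      simp only [op13, op23, conj_comp_apply, rotate_tmul, LinearMap.lTensor_tmul,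
        TensorProduct.comm_symm_tmul, TensorProduct.leftComm_symm_tmul]
      generalize g (j ⊗ₜ x) = u
      induction u with
      | zero => simp
      | add y z hy hz => simp only [map_add, TensorProduct.tmul_add, hy, hz]
      | tmul y z => simp

theorem op12_op12 (g g' : Module.End ℂ (V₀ ⊗[ℂ] I)) (hg : g ∘ₗ g' = LinearMap.id)
    (t : V₀ ⊗[ℂ] (I ⊗[ℂ] J)) : op12 J g (op12 J g' t) = t := by
  simp only [op12, conj_comp_apply, LinearEquiv.symm_apply_apply]
  rw [← LinearMap.comp_apply (g.rTensor J), ← LinearMap.rTensor_comp, hg, LinearMap.rTensor_id]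
  simp

theorem op13_op13 (g g' : Module.End ℂ (V₀ ⊗[ℂ] J)) (hg : g ∘ₗ g' = LinearMap.id)
    (t : V₀ ⊗[ℂ] (I ⊗[ℂ] J)) : op13 I g (op13 I g' t) = t := by
  simp only [op13, conj_comp_apply, LinearEquiv.symm_apply_apply]
  rw [← LinearMap.comp_apply (g.lTensor I), ← LinearMap.lTensor_comp, hg, LinearMap.lTensor_id]
  simp

theorem lTensor_op12 (g : Module.End ℂ (V₀ ⊗[ℂ] J)) (f : M →ₗ[ℂ] N) (t : V₀ ⊗[ℂ] (J ⊗[ℂ] M)) :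
    (f.lTensor J).lTensor V₀ (op12 M g t) = op12 N g ((f.lTensor J).lTensor V₀ t) := by
  induction t with
  | zero => simp
  | add x y hx hy => simp only [map_add, hx, hy]
  | tmul x t =>
    induction t with
    | zero => simp
    | add y z hy hz => simp only [map_add, TensorProduct.tmul_add, hy, hz]
    | tmul j i =>
      simp only [op12, conj_comp_apply, LinearMap.lTensor_tmul,
        TensorProduct.assoc_symm_tmul, LinearMap.rTensor_tmul]
      generalize g (x ⊗ₜ j) = u
      induction u with
      | zero => simp
      | add y z hy hz => simp only [map_add, TensorProduct.add_tmul, hy, hz]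
      | tmul y z => simp

theorem lTensor_op13 (L : Module.End ℂ (V₀ ⊗[ℂ] M)) (L' : Module.End ℂ (V₀ ⊗[ℂ] N))
    (f : M →ₗ[ℂ] N) (hf : L' ∘ₗ f.lTensor V₀ = f.lTensor V₀ ∘ₗ L) (t : V₀ ⊗[ℂ] (J ⊗[ℂ] M)) :
    (f.lTensor J).lTensor V₀ (op13 J L t) = op13 J L' ((f.lTensor J).lTensor V₀ t) := by
  induction t with
  | zero => simp
  | add x y hx hy => simp only [map_add, hx, hy]
  | tmul x t =>
    induction t with
    | zero => simp
    | add y z hy hz => simp only [map_add, TensorProduct.tmul_add, hy, hz]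
    | tmul j i =>
      have e := LinearMap.congr_fun hf (x ⊗ₜ i)
      simp only [LinearMap.comp_apply, LinearMap.lTensor_tmul] at e
      simp only [op13, conj_comp_apply, LinearMap.lTensor_tmul,
        TensorProduct.leftComm_symm_tmul, e]
      generalize L (x ⊗ₜ i) = u
      induction u with
      | zero => simp
      | add y z hy hz => simp only [map_add, TensorProduct.tmul_add, hy, hz]
      | tmul y z => simp

theorem conj_comp_conj_symm {X Y : Type*} [AddCommGroup X] [Module ℂ X] [AddCommGroup Y]
    [Module ℂ Y] (e : X ≃ₗ[ℂ] Y) (g : X ≃ₗ[ℂ] X) :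
    e.conj g.toLinearMap ∘ₗ e.conj g.symm.toLinearMap = LinearMap.id := by
  ext t
  simp [conj_comp_apply]

/-- The inverse of a factorisation `G = g₁₃ g₂₃`, with the third factor moved to the front. -/
theorem comm_conj_symm_eq (G : ((I ⊗[ℂ] J) ⊗[ℂ] V₀) ≃ₗ[ℂ] ((I ⊗[ℂ] J) ⊗[ℂ] V₀))
    (g₁ : (I ⊗[ℂ] V₀) ≃ₗ[ℂ] (I ⊗[ℂ] V₀)) (g₂ : (J ⊗[ℂ] V₀) ≃ₗ[ℂ] (J ⊗[ℂ] V₀))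
    (hG : (TensorProduct.assoc ℂ I J V₀).conj G.toLinearMap
      = op13 J g₁.toLinearMap * op23 I g₂.toLinearMap) (t : V₀ ⊗[ℂ] (I ⊗[ℂ] J)) :
    (TensorProduct.comm ℂ (I ⊗[ℂ] J) V₀).conj G.symm.toLinearMap t
      = op13 I ((TensorProduct.comm ℂ J V₀).conj g₂.symm.toLinearMap)
        (op12 J ((TensorProduct.comm ℂ I V₀).conj g₁.symm.toLinearMap) t) := by
  have key : ∀ s : V₀ ⊗[ℂ] (I ⊗[ℂ] J),
      (TensorProduct.comm ℂ (I ⊗[ℂ] J) V₀).conj G.toLinearMap s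
        = op12 J ((TensorProduct.comm ℂ I V₀).conj g₁.toLinearMap)
          (op13 I ((TensorProduct.comm ℂ J V₀).conj g₂.toLinearMap) s) := by
    intro s
    obtain ⟨u, rfl⟩ := (rotate I J V₀).surjective s
    have e := LinearMap.congr_fun hG u
    rw [Module.End.mul_apply, conj_comp_apply] at e
    rw [← rotate_op23, ← rotate_op13, ← e]
    simp only [rotate, LinearEquiv.trans_apply, LinearEquiv.symm_apply_apply, conj_comp_apply]
  -- This is the claimed value of the inverse at `t`. Applying the flipped `G` to it cancels the two
  -- factors in turn and returns `t`.
  set s := op13 I ((TensorProduct.comm ℂ J V₀).conj g₂.symm.toLinearMap)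
    (op12 J ((TensorProduct.comm ℂ I V₀).conj g₁.symm.toLinearMap) t) with hs
  have e := key s
  rw [hs, op13_op13 _ _ (conj_comp_conj_symm _ g₂), op12_op12 _ _ (conj_comp_conj_symm _ g₁),
    ← hs] at e
  rw [← e]
  simp [conj_comp_apply]

/-- Undoes the flip and the inverse in `R_- = (R')⁻¹`: compatibility of `f` with `R_-(V₀, ·)`
becomes compatibility with `R(·, V₀)`. -/
theorem rTensor_comm_of_symm (G : (M ⊗[ℂ] V₀) ≃ₗ[ℂ] (M ⊗[ℂ] V₀))
    (G' : (N ⊗[ℂ] V₀) ≃ₗ[ℂ] (N ⊗[ℂ] V₀)) (f : M →ₗ[ℂ] N)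
    (hf : ∀ t, (TensorProduct.comm ℂ N V₀).conj G'.symm.toLinearMap (f.lTensor V₀ t)
      = f.lTensor V₀ ((TensorProduct.comm ℂ M V₀).conj G.symm.toLinearMap t)) (t : M ⊗[ℂ] V₀) :
    G' (f.rTensor V₀ t) = f.rTensor V₀ (G t) := by
  have hc : ∀ u, f.lTensor V₀ (TensorProduct.comm ℂ M V₀ u)
      = TensorProduct.comm ℂ N V₀ (f.rTensor V₀ u) := by
    intro u
    induction u with
    | zero => simp
    | tmul x y => simp
    | add x y hx hy => simp only [map_add, hx, hy]
  have e := hf (TensorProduct.comm ℂ M V₀ (G t))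
  simp only [conj_comp_apply, LinearEquiv.symm_apply_apply, LinearEquiv.coe_coe, hc,
    EmbeddingLike.apply_eq_iff_eq] at e
  rw [← e, LinearEquiv.apply_symm_apply]

end triple

/-! ### Fusion of `R_±` on tensor products. -/

namespace UniversalRMatrix

variable (𝓡 : UniversalRMatrix D h)

theorem plus_tensor (V I J : QRep D h) (t : V.carrier ⊗[ℂ] (I.carrier ⊗[ℂ] J.carrier)) :
    𝓡.plus V (I.tensor J) t
      = op13 I.carrier (𝓡.plus V J) (op12 J.carrier (𝓡.plus V I) t) :=
  LinearMap.congr_fun (𝓡.id_comul V I J) t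

/-- Inversion reverses the order in `(Δ ⊗ id) R = R₁₃ R₂₃` and the flip relabels the factors, so
`R_-` obeys the same fusion rule as `R_+`. -/
theorem minus_tensor (V I J : QRep D h) (t : V.carrier ⊗[ℂ] (I.carrier ⊗[ℂ] J.carrier)) :
    𝓡.minus V (I.tensor J) t
      = op13 I.carrier (𝓡.minus V J) (op12 J.carrier (𝓡.minus V I) t) :=
  comm_conj_symm_eq (𝓡.R (I.tensor J) V) (𝓡.R I V) (𝓡.R J V) (𝓡.comul_id I J V) t

end UniversalRMatrix

/-! ### Tensor operators on the model space -/

section modelSpace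

variable {Λ : Type*} [DecidableEq Λ] (irr : Λ → QRep D h)

/-- The inclusion of `V^K` into the model space. -/
abbrev inclusion (K : Λ) : (irr K).carrier →ₗ[ℂ] ModelSpace irr :=
  DirectSum.lof ℂ Λ (fun K => (irr K).carrier) K

/-- The projection of the model space to `V^K`. -/
abbrev projection (K : Λ) : ModelSpace irr →ₗ[ℂ] (irr K).carrier :=
  DirectSum.component ℂ Λ (fun K => (irr K).carrier) K

variable (V : QRep D h) (R : ∀ W : QRep D h, Module.End ℂ (V.carrier ⊗[ℂ] W.carrier))

/-- Together with `projection_comp_lOp` this expresses that `L` is block diagonal over the summands,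
so that the exchange relation restricts to single components. -/
theorem lOp_comp_inclusion (K : Λ) :
    lOp irr V R ∘ₗ (inclusion irr K).lTensor V.carrier
      = (inclusion irr K).lTensor V.carrier ∘ₗ R (irr K) := by
  refine TensorProduct.ext' fun v x => ?_
  rw [LinearMap.comp_apply, LinearMap.comp_apply, LinearMap.lTensor_tmul, lOp, conj_comp_apply,
    LinearEquiv.symm_symm, TensorProduct.directSumRight_tmul_lof, DirectSum.lmap_lof]
  generalize R (irr K) (v ⊗ₜ x) = u
  induction u with
  | zero => simp
  | add y z hy hz => simp only [map_add, hy, hz]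
  | tmul y z => rw [TensorProduct.directSumRight_symm_lof_tmul, LinearMap.lTensor_tmul]

theorem projection_comp_lOp (K : Λ) :
    R (irr K) ∘ₗ (projection irr K).lTensor V.carrier
      = (projection irr K).lTensor V.carrier ∘ₗ lOp irr V R := by
  refine TensorProduct.ext' fun v x => ?_
  induction x using DirectSum.induction_on with
  | zero => simp
  | add y z hy hz => rw [TensorProduct.tmul_add, map_add, map_add, hy, hz]
  | of L x =>
    change _ = (projection irr K).lTensor V.carrier (lOp irr V R
      ((inclusion irr L).lTensor V.carrier (v ⊗ₜ x)))
    rw [← LinearMap.comp_apply (lOp irr V R), lOp_comp_inclusion, LinearMap.comp_apply,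
      LinearMap.comp_apply, ← LinearMap.comp_apply (LinearMap.lTensor _ (projection irr K)),
      ← LinearMap.lTensor_comp]
    change R (irr K) (v ⊗ₜ (projection irr K ∘ₗ inclusion irr L) x) = _
    by_cases hKL : L = K
    · subst hKL
      have : projection irr L ∘ₗ inclusion irr L = LinearMap.id := by
        exact LinearMap.ext fun x => DirectSum.component.lof_self ℂ (M := fun K => (irr K).carrier) L x
      rw [this, LinearMap.lTensor_id]; rfl
    · have : projection irr K ∘ₗ inclusion irr L = 0 := by
        refine LinearMap.ext fun x => ?_
        rw [LinearMap.comp_apply, DirectSum.component.of, dif_neg hKL, LinearMap.zero_apply]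
      rw [this, LinearMap.lTensor_zero]; simp

/-- The component `V^I ⊗ J → V^K` of a row of operators on the model space. -/
def rowComponent {J : Type*} [AddCommGroup J] [Module ℂ J]
    (U : J ⊗[ℂ] ModelSpace irr →ₗ[ℂ] ModelSpace irr) (I K : Λ) :
    (irr I).carrier ⊗[ℂ] J →ₗ[ℂ] (irr K).carrier :=
  projection irr K ∘ₗ U ∘ₗ (inclusion irr I).lTensor J ∘ₗ
    (TensorProduct.comm ℂ (irr I).carrier J).toLinearMap

/-- The components of a row that satisfies the exchange relation commute with the operators
`R(V, ·)`. -/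
theorem ExchangeRelation.rowComponent_comm {J : QRep D h}
    {U : J.carrier ⊗[ℂ] ModelSpace irr →ₗ[ℂ] ModelSpace irr}
    (hU : ExchangeRelation (lOp irr V R) (R J) U) (I K : Λ)
    (t : V.carrier ⊗[ℂ] ((irr I).carrier ⊗[ℂ] J.carrier)) :
    R (irr K) ((rowComponent irr U I K).lTensor V.carrier t)
      = (rowComponent irr U I K).lTensor V.carrier
        (op13 (irr I).carrier (R J) (op12 J.carrier (R (irr I)) t)) := by
  obtain ⟨s, rfl⟩ : ∃ s, (TensorProduct.comm ℂ J.carrier (irr I).carrier).toLinearMap.lTensor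
      V.carrier s = t := LinearMap.lTensor_surjective _ (LinearEquiv.surjective _) t
  have hcc : ∀ s, (TensorProduct.comm ℂ (irr I).carrier J.carrier).toLinearMap.lTensor V.carrier
      ((TensorProduct.comm ℂ J.carrier (irr I).carrier).toLinearMap.lTensor V.carrier s) = s := by
    intro s
    rw [← LinearMap.comp_apply, ← LinearMap.lTensor_comp]
    have hid : (TensorProduct.comm ℂ (irr I).carrier J.carrier).toLinearMap ∘ₗ
        (TensorProduct.comm ℂ J.carrier (irr I).carrier).toLinearMap = LinearMap.id :=
      TensorProduct.ext' fun x y => by simp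
    rw [hid, LinearMap.lTensor_id, LinearMap.id_apply]
  -- The row takes `J` before the model space, whereas Clebsch-Gordan maps take `V^I` before `J`.
  -- The flip turns `R₁₃ R₁₂` on `V ⊗ (V^I ⊗ J)` into the product `R₁₂ L₁₃` of the exchange
  -- relation.
  rw [← lTensor_comm_op13, ← lTensor_comm_op12]
  simp only [rowComponent, LinearMap.lTensor_comp, LinearMap.comp_apply, hcc]
  rw [lTensor_op12, lTensor_op13 _ _ _ (lOp_comp_inclusion irr V R I)]
  have e1 := LinearMap.congr_fun hU (((inclusion irr I).lTensor J.carrier).lTensor V.carrier s)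
  have e2 := LinearMap.congr_fun (projection_comp_lOp irr V R K) (U.lTensor V.carrier
    (((inclusion irr I).lTensor J.carrier).lTensor V.carrier s))
  simp only [LinearMap.comp_apply] at e1 e2
  rw [e2, e1]

/-- By fusion, the two exchange relations say that the component commutes with `R(I₀, ·)` and, after
inversion, with `R(·, I₀)`; `isIntertwiner_of_commutes` applies. -/
theorem rowComponent_isIntertwiner (hq : ∀ r : ℕ, 0 < r → Complex.exp h ^ r ≠ 1)
    (𝓡 : UniversalRMatrix D h) {I₀ : QRep D h} (hI₀ : I₀.IsIrreducible)
    (hI₀' : 1 < Module.finrank ℂ I₀.carrier) {J : QRep D h} {n : ℕ}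
    (e : Module.Basis (Fin n) ℂ J.carrier) (T : Fin n → Module.End ℂ (ModelSpace irr))
    (hT : IsTensorOperator 𝓡 irr I₀ J e T) (I K : Λ) :
    IsIntertwiner ((irr I).tensor J) (irr K) (rowComponent irr (row e T) I K) := by
  refine isIntertwiner_of_commutes 𝓡 hq hI₀ hI₀' (fun t => ?_) fun t => ?_
  · exact (hT.1.rowComponent_comm irr I₀ (𝓡.plus I₀) I K t).trans
      (congrArg _ (𝓡.plus_tensor I₀ (irr I) J t).symm)
  · exact rTensor_comm_of_symm (𝓡.R ((irr I).tensor J) I₀) (𝓡.R (irr K) I₀)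
      (rowComponent irr (row e T) I K)
      (fun t => (hT.2.rowComponent_comm irr I₀ (𝓡.minus I₀) I K t).trans
        (congrArg _ (𝓡.minus_tensor I₀ (irr I) J t).symm)) t

theorem rowComponent_tmul {J : QRep D h} {nJ : ℕ} (eJ : Module.Basis (Fin nJ) ℂ J.carrier)
    (T : Fin nJ → Module.End ℂ (ModelSpace irr)) (I K : Λ) (x : (irr I).carrier) (m : Fin nJ) :
    rowComponent irr (row eJ T) I K (x ⊗ₜ eJ m) = T m (inclusion irr I x) K := by
  simp only [rowComponent, row, LinearMap.comp_apply, LinearEquiv.coe_coe,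
    TensorProduct.comm_tmul, LinearMap.lTensor_tmul, TensorProduct.lift.tmul,
    Module.Basis.constr_basis]
  rfl

end modelSpace

end QG

end

/-- Wigner-Eckart theorem for `q`-tensor operators on the model space of `U_q(g)`. -/
theorem mainTheorem1 {ι : Type*} [Fintype ι] [DecidableEq ι] (D : QG.CartanDatum ι) (h : ℂ)
    -- `q = exp h` is not a root of unity
    (hq : ∀ r : ℕ, 0 < r → Complex.exp h ^ r ≠ 1)
    (𝓡 : QG.UniversalRMatrix D h)
    -- the model space, with a basis `|K m⟩`
    {Λ : Type*} [DecidableEq Λ] (irr : Λ → QG.QRep D h) (hirr : QG.IsIrrepList irr)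
    (n : Λ → ℕ) (e : ∀ K, Module.Basis (Fin (n K)) ℂ (irr K).carrier)
    -- the representation `ρ^{I₀}` of the `L`-operators: irreducible and nontrivial
    (I₀ : QG.QRep D h) (hI₀ : I₀.IsIrreducible) (hI₀' : 1 < Module.finrank ℂ I₀.carrier)
    -- a tensor operator, transforming by a finite dimensional representation `ρ^J`
    (J : QG.QRep D h) (nJ : ℕ) (eJ : Module.Basis (Fin nJ) ℂ J.carrier)
    (T : Fin nJ → Module.End ℂ (QG.ModelSpace irr))
    (hT : QG.IsTensorOperator 𝓡 irr I₀ J eJ T)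
    -- Clebsch-Gordan maps for the tensor products `V^I ⊗ V^J`
    (cg : ∀ I, QG.ClebschGordan irr (irr I) J) :
    ∃ red : ∀ I K, Fin ((cg I).mult K) → ℂ,
      -- the expansion of `T_m |I m'⟩`
      (∀ I m m', T m (QG.ket e I m') = ∑ K ∈ (cg I).support, ∑ a, red I K a •
        ∑ m'', (cg I).coeff (e I) eJ e K a m' m m'' • QG.ket e K m'') ∧
      -- the matrix elements, in general and for components of multiplicity one
      (∀ I K m m' m'', QG.matrixElement e (T m) K m'' I m' =
        ∑ a, red I K a * (cg I).coeff (e I) eJ e K a m' m m'') ∧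
      (∀ I K, (cg I).mult K = 1 → ∀ a m m' m'', QG.matrixElement e (T m) K m'' I m' =
        red I K a * (cg I).coeff (e I) eJ e K a m' m m'') := by
  -- The reduced matrix elements are the Schur coefficients of the components of the row. They
  -- depend on the maps alone, hence not on `m`, `m'`, `m''`.
  choose red hred using fun I K => (cg I).exists_eq_sum hirr
    (QG.rowComponent_isIntertwiner irr hq 𝓡 hI₀ hI₀' eJ T hT I K)
  have hcomp : ∀ I K m m', T m (QG.ket e I m') K
      = ∑ a, red I K a • (cg I).C K a (e I m' ⊗ₜ eJ m) := by
    intro I K m m'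
    have := LinearMap.congr_fun (hred I K) (e I m' ⊗ₜ eJ m)
    rw [QG.rowComponent_tmul, LinearMap.sum_apply] at this
    exact this
  have hmat : ∀ I K m m' m'', QG.matrixElement e (T m) K m'' I m' =
      ∑ a, red I K a * (cg I).coeff (e I) eJ e K a m' m m'' := by
    intro I K m m' m''
    simp [QG.matrixElement, hcomp, QG.ClebschGordan.coeff, Finsupp.finsetSum_apply]
  refine ⟨red, fun I m m' => ?_, hmat, fun I K hK a m m' m'' => ?_⟩
  · have hterm : ∀ K a, red I K a • ∑ m'', (cg I).coeff (e I) eJ e K a m' m m'' • QG.ket e K m''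
        = QG.inclusion irr K (red I K a • (cg I).C K a (e I m' ⊗ₜ eJ m)) := by
      intro K a
      rw [map_smul]
      conv_rhs => rw [← (e K).sum_repr ((cg I).C K a (e I m' ⊗ₜ eJ m)), map_sum]
      simp only [map_smul]
      rfl
    simp only [hterm, ← map_sum, ← hcomp]
    refine DFinsupp.ext fun K => ?_
    change _ = QG.projection irr K _
    rw [map_sum]
    by_cases hK : K ∈ (cg I).support
    · rw [Finset.sum_eq_single_of_mem K hK fun L _ (hL : L ≠ K) => by
        rw [DirectSum.component.of, dif_neg hL], DirectSum.component.lof_self]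
    -- Outside the support the multiplicity is zero, so the component of `T_m |I m'⟩` is an empty
    -- sum, and no summand on the right lies in `V^K`.
    · have h0 : (cg I).mult K = 0 := not_not.1 fun h0 => hK (((cg I).mem_support K).2 h0)
      have : IsEmpty (Fin ((cg I).mult K)) := by rw [h0]; infer_instance
      rw [hcomp, Finset.univ_eq_empty, Finset.sum_empty]
      refine (Finset.sum_eq_zero fun L hL => ?_).symm
      rw [DirectSum.component.of, dif_neg fun hLK : L = K => hK (hLK ▸ hL)]
  · rw [hmat]
    have : Subsingleton (Fin ((cg I).mult K)) := by rw [hK]; infer_instance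
    exact Fintype.sum_subsingleton _ a
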